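/- Let $n,m$ be non-negative integers and let $\Gamma\subset\mathbb{R}^n\times\mathbb{R}^m$ be a (full-rank) lattice in general position: the coordinate projections $p_1:\mathbb{R}^n\times\mathbb{R}^m\to\mathbb{R}^n$ and $p_2:\mathbb{R}^n\times\mathbb{R}^m\to\mathbb{R}^m$ are injective on $\Gamma$, and $p_1(\Gamma)$, $p_2(\Gamma)$ are dense in $\mathbb{R}^n$, $\mathbb{R}^m$ respectively. Let $\Gamma^*=\{\gamma^* : \langle\gamma,\gamma^*\rangle\in\mathbb{Z}\text{ for all }\gamma\in\Gamma\}$ be the dual lattice. Let $U\subset\mathbb{R}^n$ and $V\subset\mathbb{R}^m$ be bounded Riemann measurable sets (that is, bounded sets whose boundaries have Lebesgue measure zero), and put $$\Lambda(\Gamma,V)=\{p_1(\gamma):\gamma\in\Gamma,\ p_2(\gamma)\in V\}\subset\mathbb{R}^n,\qquad \Lambda^*(\Gamma,U)=\{p_2(\gamma^*):\gamma^*\in\Gamma^*,\ p_1(\gamma^*)\in U\}\subset\mathbb{R}^m.$$ For $\Lambda\subset\mathbb{R}^k$ write $E(\Lambda)=\{e^{2\pi i\langle\lambda,x\rangle}\}_{\lambda\in\Lambda}$.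 A system $\{f_j\}$ in a Hilbert space $H$ is a frame if there are constants $A,B>0$ with $A\|f\|^2\le\sum_j|\langle f,f_j\rangle|^2\le B\|f\|^2$ for all $f\in H$; it is a Riesz sequence if there are $A,B>0$ with $A\sum_j|c_j|^2\le\|\sum_j c_jf_j\|^2\le B\sum_j|c_j|^2$ for all finite systems of scalars $\{c_j\}$; it is a Riesz basis if every $f\in H$ has a unique (unconditionally convergent) expansion $f=\sum_j c_jf_j$, and $A\|f\|^2\le\sum_j|c_j|^2\le B\|f\|^2$ with constants $A,B>0$ independent of $f$. Suppose that either $\partial V\cap p_2(\Gamma)=\emptyset$, or $m=1$ and $V$ is a semi-closed interval $[a,b)$ or $(a,b]$ with $a<b$. Then: 1. if $E(\Lambda^*(\Gamma,U))$ is a frame in $L^2(V)$, then $E(\Lambda(\Gamma,V))$ is a Riesz sequence in $L^2(U)$; 2. if $E(\Lambda^*(\Gamma,U))$ is a Riesz sequence in $L^2(V)$, then $E(\Lambda(\Gamma,V))$ is a frame in $L^2(U)$; 3. if $E(\Lambda^*(\Gamma,U))$ is a Riesz basis in $L^2(V)$, then $E(\Lambda(\Gamma,V))$ is a Riesz basis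 in $L^2(U)$. -/

import Mathlib

open MeasureTheory

namespace ModelSetDuality

/-- The Euclidean space `ℝᵏ`. -/
abbrev Euc (k : ℕ) : Type := EuclideanSpace ℝ (Fin k)

section Systems

variable {ι : Type*} {H : Type*} [NormedAddCommGroup H] [InnerProductSpace ℂ H]

/-- `f` is a frame in `H`: `A ‖x‖² ≤ ∑ₙ |⟨x, fₙ⟩|² ≤ B ‖x‖²` for all `x`. -/
def IsFrame (f : ι → H) : Prop :=
  ∃ A B : ℝ, 0 < A ∧ 0 < B ∧ ∀ x : H,
    Summable (fun i => ‖(inner ℂ (f i) x : ℂ)‖ ^ 2) ∧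
    A * ‖x‖ ^ 2 ≤ ∑' i, ‖(inner ℂ (f i) x : ℂ)‖ ^ 2 ∧
    ∑' i, ‖(inner ℂ (f i) x : ℂ)‖ ^ 2 ≤ B * ‖x‖ ^ 2

/-- `f` is a Riesz sequence in `H`: `A ∑ |cₙ|² ≤ ‖∑ cₙ fₙ‖² ≤ B ∑ |cₙ|²` for all finite
systems of scalars. -/
def IsRieszSequence (f : ι → H) : Prop :=
  ∃ A B : ℝ, 0 < A ∧ 0 < B ∧ ∀ (s : Finset ι) (c : ι → ℂ),
    A * ∑ i ∈ s, ‖c i‖ ^ 2 ≤ ‖∑ i ∈ s, c i • f i‖ ^ 2 ∧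
    ‖∑ i ∈ s, c i • f i‖ ^ 2 ≤ B * ∑ i ∈ s, ‖c i‖ ^ 2

/-- `f` is a Riesz basis of `H`: every `x` has a unique expansion `x = ∑ cₙ fₙ`, and
`A ‖x‖² ≤ ∑ |cₙ|² ≤ B ‖x‖²` with `A`, `B` independent of `x`. -/
def IsRieszBasis (f : ι → H) : Prop :=
  ∃ A B : ℝ, 0 < A ∧ 0 < B ∧ ∀ x : H, ∃ c : ι → ℂ,
    HasSum (fun i => c i • f i) x ∧
    (∀ c' : ι → ℂ, HasSum (fun i => c' i • f i) x → c' = c) ∧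
    Summable (fun i => ‖c i‖ ^ 2) ∧
    A * ‖x‖ ^ 2 ≤ ∑' i, ‖c i‖ ^ 2 ∧
    ∑' i, ‖c i‖ ^ 2 ≤ B * ‖x‖ ^ 2

end Systems

/-- A bounded set whose boundary has Lebesgue measure zero. -/
structure RiemannMeasurable {k : ℕ} (S : Set (Euc k)) : Prop where
  bounded : Bornology.IsBounded S
  null_frontier : volume (frontier S) = 0

/-- The exponential function `x ↦ exp (2 π i ⟨lam, x⟩)`. -/
noncomputable def expFun {k : ℕ} (lam : Euc k) (x : Euc k) : ℂ :=
  Complex.exp (2 * (Real.pi : ℂ) * Complex.I * ((inner ℝ lam x : ℝ) : ℂ))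

theorem continuous_expFun {k : ℕ} (lam : Euc k) : Continuous (expFun lam) := by
  unfold expFun
  fun_prop

theorem norm_expFun {k : ℕ} (lam x : Euc k) : ‖expFun lam x‖ = 1 := by
  have h : 2 * (Real.pi : ℂ) * Complex.I * ((inner ℝ lam x : ℝ) : ℂ) =
      ((2 * Real.pi * (inner ℝ lam x : ℝ) : ℝ) : ℂ) * Complex.I := by
    push_cast
    ring
  rw [expFun, h, Complex.norm_exp_ofReal_mul_I]

theorem memLp_expFun {k : ℕ} {S : Set (Euc k)} (hS : Bornology.IsBounded S) (lam : Euc k) :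
    MemLp (expFun lam) 2 (volume.restrict S) := by
  haveI : IsFiniteMeasure (volume.restrict S) :=
    ⟨by rw [Measure.restrict_apply_univ]; exact hS.measure_lt_top⟩
  exact MemLp.of_bound (continuous_expFun lam).aestronglyMeasurable 1
    (Filter.Eventually.of_forall fun x => (norm_expFun lam x).le)

/-- The exponential system `E(Λ)`, indexed by `Λ`, as vectors of `L²(S)`, for bounded `S`. -/
noncomputable def expSystem {k : ℕ} (Lam : Set (Euc k)) {S : Set (Euc k)}
    (hS : Bornology.IsBounded S) : Lam → Lp ℂ 2 (volume.restrict S) :=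
  fun lam => (memLp_expFun hS (lam : Euc k)).toLp (expFun (lam : Euc k))

/-- The dual lattice: all vectors with integral Euclidean inner product with every element
of `Γ`. -/
def dualLattice {n m : ℕ} (Γ : Submodule ℤ (Euc n × Euc m)) :
    Submodule ℤ (Euc n × Euc m) where
  carrier := {y | ∀ x ∈ Γ, ∃ k : ℤ, (inner ℝ x.1 y.1 : ℝ) + (inner ℝ x.2 y.2 : ℝ) = (k : ℝ)}
  zero_mem' := fun x _ => ⟨0, by simp⟩
  add_mem' := by
    intro a b ha hb x hx
    obtain ⟨k, hk⟩ := ha x hx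
    obtain ⟨l, hl⟩ := hb x hx
    refine ⟨k + l, ?_⟩
    simp only [Prod.fst_add, Prod.snd_add, inner_add_right]
    push_cast
    linarith
  smul_mem' := by
    intro c a ha x hx
    obtain ⟨k, hk⟩ := ha x hx
    refine ⟨c * k, ?_⟩
    rw [← Int.cast_smul_eq_zsmul ℝ c a]
    simp only [Prod.smul_fst, Prod.smul_snd, inner_smul_right]
    push_cast
    rw [← hk]
    ring

/-- Both coordinate projections are injective on `Γ` and have dense images. -/
structure GeneralPosition {n m : ℕ} (Γ : Submodule ℤ (Euc n × Euc m)) : Prop where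
  injOn_fst : Set.InjOn Prod.fst (Γ : Set (Euc n × Euc m))
  injOn_snd : Set.InjOn Prod.snd (Γ : Set (Euc n × Euc m))
  dense_fst : Dense (Prod.fst '' (Γ : Set (Euc n × Euc m)))
  dense_snd : Dense (Prod.snd '' (Γ : Set (Euc n × Euc m)))

/-- `Λ(Γ, V) = {p₁(γ) : γ ∈ Γ, p₂(γ) ∈ V}`. -/
def modelSet {n m : ℕ} (Γ : Submodule ℤ (Euc n × Euc m)) (V : Set (Euc m)) : Set (Euc n) :=
  {x | ∃ y ∈ Γ, y.2 ∈ V ∧ y.1 = x}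

/-- `Λ*(Γ, U) = {p₂(γ*) : γ* ∈ Γ*, p₁(γ*) ∈ U}`. -/
def dualModelSet {n m : ℕ} (Γ : Submodule ℤ (Euc n × Euc m)) (U : Set (Euc n)) : Set (Euc m) :=
  {x | ∃ y ∈ dualLattice Γ, y.1 ∈ U ∧ y.2 = x}

/-- `m = 1` and `V` is an interval `[a, b)` or `(a, b]` of `ℝ`. -/
def IsSemiClosedInterval {m : ℕ} (V : Set (Euc m)) : Prop :=
  m = 1 ∧ ∃ a b : ℝ, a < b ∧
    (V = {v | ∀ i, v i ∈ Set.Ico a b} ∨ V = {v | ∀ i, v i ∈ Set.Ioc a b})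

end ModelSetDuality

/-!
Poisson summation between `Γ` and `Γ*` is applied to products of a function on `ℝⁿ` and a rescaled
bump on `ℝᵐ`. The bumps are normalised in `L²`, have scale `ε → 0`, and sit at the points `p₂(γ)`,
shifted by `ε u` so as to avoid the boundary of `V`. Asymptotically they are orthogonal in `L²(V)`,
and only those with `p₂(γ) ∈ V` keep a mass.

For a finite sum of such bumps, the inner product with the exponential of frequency `p₂(γ*)` is
`√εᵐ f(p₁(γ*)) φ̂(ε p₂(γ*))`, where `f` is the trigonometric polynomial with frequencies `p₁(γ)` and
the same coefficients. Since `p₂` is injective on `Γ`, the squares of these numbers, summed over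
the `γ*` with `p₁(γ*) ∈ U`, tend to a constant times `∫_U |f|²`. The frame inequalities therefore
become Riesz inequalities for `f`. Conversely, for a smooth `f` supported in `U` the same numbers
are test coefficients for the Riesz inequalities, and Poisson summation turns the corresponding
combination of exponentials into a sum of bumps with coefficients `f̂(p₁(γ))`, which gives the frame
inequalities for `f`. A Riesz basis is the same thing as a frame that is a Riesz sequence.
-/

open MeasureTheory Filter Topology FourierTransform SchwartzMap
open scoped ContDiff

namespace ModelSetDuality

/-! ### Polynomial decay -/

section Decay

variable {E F : Type*} [NormedAddCommGroup E] [NormedAddCommGroup F] {r : ℕ}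

/-- The polynomial weight `(1 + ‖x‖)⁻ʳ`, summable over a lattice once `r` exceeds its rank. -/
noncomputable def decayWeight (r : ℕ) (x : E) : ℝ := ((1 + ‖x‖) ^ r)⁻¹

theorem decayWeight_pos (r : ℕ) (x : E) : 0 < decayWeight r x := by
  unfold decayWeight
  positivity

theorem decayWeight_nonneg (r : ℕ) (x : E) : 0 ≤ decayWeight r x := (decayWeight_pos r x).le

theorem decayWeight_le_one (r : ℕ) (x : E) : decayWeight r x ≤ 1 :=
  inv_le_one_of_one_le₀ (one_le_pow₀ (by linarith [norm_nonneg x]))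

theorem decayWeight_le_mul {x : E} {y : F} {M : ℝ} (h : 1 + ‖y‖ ≤ M * (1 + ‖x‖)) :
    decayWeight r x ≤ M ^ r * decayWeight r y := by
  unfold decayWeight
  rw [← div_eq_mul_inv, le_div_iff₀ (by positivity), inv_mul_le_iff₀ (by positivity), ← mul_pow,
    mul_comm _ M]
  gcongr

theorem decayWeight_anti {x : E} {y : F} (h : ‖x‖ ≤ ‖y‖) : decayWeight r y ≤ decayWeight r x := by
  simpa using decayWeight_le_mul (r := r) (M := 1) (x := y) (y := x) (by linarith)

theorem decayWeight_add_le {x y : E} {R : ℝ} (hx : ‖x‖ ≤ R) :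
    decayWeight r (x + y) ≤ (1 + R) ^ r * decayWeight r y := by
  refine decayWeight_le_mul ?_
  have hy : ‖y‖ ≤ ‖x‖ + ‖x + y‖ := by
    simpa [add_comm] using norm_sub_le (x + y) x
  nlinarith [norm_nonneg x, norm_nonneg (x + y)]

theorem one_le_mul_decayWeight {x : E} {R : ℝ} (hx : ‖x‖ ≤ R) :
    1 ≤ (1 + R) ^ r * decayWeight r x := by
  simpa [decayWeight] using decayWeight_le_mul (r := r) (x := (0 : E)) (y := x) (M := 1 + R)
    (by simpa using hx)

theorem decayWeight_fst_mul_decayWeight_snd_le (r : ℕ) (z : E × F) :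
    decayWeight r z.1 * decayWeight r z.2 ≤ decayWeight r z := by
  rcases le_total ‖z.1‖ ‖z.2‖ with h | h
  · exact (mul_le_of_le_one_left (decayWeight_nonneg _ _) (decayWeight_le_one _ _)).trans
      (decayWeight_anti (by simp [Prod.norm_def, h]))
  · exact (mul_le_of_le_one_right (decayWeight_nonneg _ _) (decayWeight_le_one _ _)).trans
      (decayWeight_anti (by simp [Prod.norm_def, h]))

theorem summable_decayWeight [NormedSpace ℝ E] [FiniteDimensional ℝ E] (L : Submodule ℤ E)
    [DiscreteTopology L] [IsZLattice ℝ L] (hr : Module.finrank ℝ E < r) :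
    Summable fun z : L => decayWeight r (z : E) := by
  have hrank : Module.finrank ℤ L < r := by rwa [ZLattice.rank ℝ L]
  refine Summable.of_norm_bounded_eventually (ZLattice.summable_norm_pow_inv L r hrank) ?_
  filter_upwards [(Set.finite_singleton (0 : L)).compl_mem_cofinite] with z hz
  have : 0 < ‖z‖ := norm_pos_iff.2 hz
  rw [Real.norm_of_nonneg (decayWeight_nonneg _ _), decayWeight, inv_pow]
  apply inv_anti₀ (by positivity)
  gcongr
  simp

/-- Continuous functions with polynomial decay of order `r`: the test functions for which the
lattice sums below are controlled by `summable_decayWeight`. -/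
structure Decays (r : ℕ) (f : E → ℂ) : Prop where
  continuous : Continuous f
  exists_norm_le : ∃ C, 0 ≤ C ∧ ∀ x, ‖f x‖ ≤ C * decayWeight r x

namespace Decays

variable {f : E → ℂ}

theorem mul_of_norm_le_one (hf : Decays r f) {e : E → ℂ} (he : Continuous e)
    (he' : ∀ x, ‖e x‖ ≤ 1) : Decays r fun x => e x * f x := by
  obtain ⟨C, hC, hle⟩ := hf.exists_norm_le
  refine ⟨he.mul hf.continuous, C, hC, fun x => ?_⟩
  rw [norm_mul]
  exact (mul_le_of_le_one_left (norm_nonneg _) (he' x)).trans (hle x)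

theorem exists_norm_mul_le {g : F → ℂ} (hf : Decays r f) (hg : Decays r g) :
    ∃ C, 0 ≤ C ∧ ∀ x y, ‖f x * g y‖ ≤ C * (decayWeight r x * decayWeight r y) := by
  obtain ⟨C, hC, hle⟩ := hf.exists_norm_le
  obtain ⟨D, hD, hle'⟩ := hg.exists_norm_le
  refine ⟨C * D, by positivity, fun x y => ?_⟩
  rw [norm_mul, mul_mul_mul_comm]
  exact mul_le_mul (hle x) (hle' y) (norm_nonneg _) ((norm_nonneg _).trans (hle x))

theorem prod_mul {g : F → ℂ} (hf : Decays r f) (hg : Decays r g) :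
    Decays r fun z : E × F => f z.1 * g z.2 := by
  obtain ⟨C, hC, hle⟩ := hf.exists_norm_mul_le hg
  have hfc := hf.continuous
  have hgc := hg.continuous
  exact ⟨by fun_prop, C, hC, fun z => (hle _ _).trans <|
    mul_le_mul_of_nonneg_left (decayWeight_fst_mul_decayWeight_snd_le r z) hC⟩

theorem exists_norm_add_le (hf : Decays r f) {R : ℝ} (hR : 0 ≤ R) :
    ∃ C, 0 ≤ C ∧ ∀ x y, ‖x‖ ≤ R → ‖f (x + y)‖ ≤ C * decayWeight r y := by
  obtain ⟨C, hC, hle⟩ := hf.exists_norm_le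
  refine ⟨C * (1 + R) ^ r, by positivity, fun x y hx => (hle _).trans ?_⟩
  rw [mul_assoc]
  exact mul_le_mul_of_nonneg_left (decayWeight_add_le hx) hC

variable [NormedSpace ℝ E]

theorem comp_continuousLinearEquiv [NormedSpace ℝ F] (hf : Decays r f) (Φ : F ≃L[ℝ] E) :
    Decays r fun x => f (Φ x) := by
  obtain ⟨C, hC, hle⟩ := hf.exists_norm_le
  refine ⟨hf.continuous.comp Φ.continuous, C * (1 + ‖(Φ.symm : E →L[ℝ] F)‖) ^ r, by positivity,
    fun x => (hle _).trans ?_⟩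
  rw [mul_assoc]
  refine mul_le_mul_of_nonneg_left (decayWeight_le_mul ?_) hC
  have hx := (Φ.symm : E →L[ℝ] F).le_opNorm (Φ x)
  simp only [ContinuousLinearEquiv.coe_coe, ContinuousLinearEquiv.symm_apply_apply] at hx
  nlinarith [norm_nonneg (Φ x), norm_nonneg (Φ.symm : E →L[ℝ] F)]

variable [FiniteDimensional ℝ E]

theorem integrable [MeasurableSpace E] [BorelSpace E] {μ : Measure E} [μ.IsAddHaarMeasure]
    (hf : Decays r f) (hr : Module.finrank ℝ E < r) : Integrable f μ := by
  obtain ⟨C, -, hle⟩ := hf.exists_norm_le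
  have hint := (integrable_one_add_norm (E := E) (μ := μ) (r := r) (mod_cast hr)).const_mul C
  refine hint.mono' hf.continuous.aestronglyMeasurable (ae_of_all _ fun x => (hle x).trans_eq ?_)
  rw [decayWeight, Real.rpow_neg (by positivity), Real.rpow_natCast]

theorem summable (hf : Decays r f) (hr : Module.finrank ℝ E < r) (L : Submodule ℤ E)
    [DiscreteTopology L] [IsZLattice ℝ L] : Summable fun z : L => f z := by
  obtain ⟨C, -, hle⟩ := hf.exists_norm_le
  exact Summable.of_norm_bounded ((summable_decayWeight L hr).mul_left C) fun z => hle z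

end Decays

end Decay

/-! ### Poisson summation for lattices -/

section IntegerLattice

variable {ι : Type*}

/-- The embedding of `ℤ^ι` into `ℝ^ι`. -/
def intVec (k : ι → ℤ) : ι → ℝ := fun i => (k i : ℝ)

theorem intVec_add (k l : ι → ℤ) : intVec (k + l) = intVec k + intVec l := by
  ext i
  simp [intVec]

/-- The projection of `ℝ^ι` onto the torus. -/
def toTorus : C(ι → ℝ, UnitAddTorus ι) where
  toFun x := fun i => (x i : UnitAddCircle)
  continuous_toFun := by fun_prop

theorem isQuotientMap_toTorus : IsQuotientMap (toTorus (ι := ι)) :=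
  (IsOpenQuotientMap.piMap fun _ : ι =>
    QuotientAddGroup.isOpenQuotientMap_mk (N := AddSubgroup.zmultiples (1 : ℝ))).isQuotientMap

theorem exists_eq_add_intVec {x y : ι → ℝ} (h : toTorus x = toTorus y) :
    ∃ k, y = x + intVec k := by
  have hcoord (i : ι) : ∃ k : ℤ, y i = x i + k := by
    have hi : ((y i - x i : ℝ) : UnitAddCircle) = 0 := by
      rw [AddCircle.coe_sub, sub_eq_zero]
      exact (congrFun h i).symm
    obtain ⟨k, hk⟩ := (AddCircle.coe_eq_zero_iff 1).1 hi
    exact ⟨k, by rw [zsmul_one] at hk; linarith⟩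
  choose k hk using hcoord
  exact ⟨k, funext hk⟩

/-- The sum of the translates of `f` by integer vectors. -/
noncomputable def periodization (f : (ι → ℝ) → ℂ) (x : ι → ℝ) : ℂ :=
  ∑' k : ι → ℤ, f (x + intVec k)

theorem periodization_add_intVec (f : (ι → ℝ) → ℂ) (x : ι → ℝ) (l : ι → ℤ) :
    periodization f (x + intVec l) = periodization f x := by
  unfold periodization
  rw [← (Equiv.addLeft l).tsum_eq fun k : ι → ℤ => f (x + intVec k)]
  exact tsum_congr fun k => by rw [Equiv.coe_addLeft, intVec_add, add_assoc]

variable [Fintype ι]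

/-- The identification of `ℤ^ι` with the lattice generated by a basis indexed by `ι`. -/
noncomputable def latticeEquiv {E : Type*} [NormedAddCommGroup E] [NormedSpace ℝ E]
    (b : Module.Basis ι ℝ E) : (ι → ℤ) ≃ Submodule.span ℤ (Set.range b) :=
  (b.restrictScalars ℤ).equivFun.symm.toEquiv

theorem coe_latticeEquiv {E : Type*} [NormedAddCommGroup E] [NormedSpace ℝ E]
    (b : Module.Basis ι ℝ E) (k : ι → ℤ) :
    (latticeEquiv b k : E) = b.equivFun.symm (intVec k) := by
  simp [latticeEquiv, Module.Basis.equivFun_symm_apply, intVec, ← Int.cast_smul_eq_zsmul ℝ]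

theorem coe_latticeEquiv_basisFun (k : ι → ℤ) :
    (latticeEquiv (Pi.basisFun ℝ ι) k : ι → ℝ) = intVec k := by
  rw [coe_latticeEquiv, LinearEquiv.symm_apply_eq, Pi.basisFun_equivFun, LinearEquiv.refl_apply]

theorem summable_decayWeight_intVec {r : ℕ} (hr : Fintype.card ι < r) :
    Summable fun k : ι → ℤ => decayWeight r (intVec k) := by
  simpa only [Function.comp_def, coe_latticeEquiv_basisFun] using
    (latticeEquiv (Pi.basisFun ℝ ι)).summable_iff.2
      (summable_decayWeight (Submodule.span ℤ (Set.range (Pi.basisFun ℝ ι))) (by simpa using hr))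

/-- The half-open unit cube, in the form in which it appears in the integral formula for Fourier
coefficients on the torus. -/
def unitCube (ι : Type*) : Set (ι → ℝ) :=
  {x | ∀ i, x i ∈ Set.Ioc ((0 : ι → ℝ) i) ((0 : ι → ℝ) i + 1)}

theorem unitCube_ae_eq_fundamentalDomain :
    unitCube ι =ᵐ[volume] ZSpan.fundamentalDomain (Pi.basisFun ℝ ι) := by
  have hIoc : unitCube ι = Set.univ.pi fun i => Set.Ioc ((0 : ι → ℝ) i) ((1 : ι → ℝ) i) := by
    ext x
    simp [unitCube]
  have hIco : ZSpan.fundamentalDomain (Pi.basisFun ℝ ι) =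
      Set.univ.pi fun i => Set.Ico ((0 : ι → ℝ) i) ((1 : ι → ℝ) i) :=
    ZSpan.fundamentalDomain_pi_basisFun
  rw [hIoc, hIco]
  exact Measure.univ_pi_Ioc_ae_eq_Icc.trans Measure.univ_pi_Ico_ae_eq_Icc.symm

theorem norm_le_one_of_mem_unitCube {x : ι → ℝ} (hx : x ∈ unitCube ι) : ‖x‖ ≤ 1 := by
  refine (pi_norm_le_iff_of_nonneg zero_le_one).2 fun i => ?_
  have hi := hx i
  simp only [Pi.zero_apply, zero_add, Set.mem_Ioc] at hi
  exact abs_le.2 ⟨by linarith, hi.2⟩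

theorem volume_unitCube_lt_top : volume (unitCube ι) < ⊤ :=
  (measure_mono fun x hx => by simpa using norm_le_one_of_mem_unitCube hx).trans_lt
    (Metric.isBounded_closedBall (x := (0 : ι → ℝ)) (r := 1)).measure_lt_top

theorem integral_eq_tsum_setIntegral_unitCube {g : (ι → ℝ) → ℂ} (hg : Integrable g) :
    ∫ x, g x = ∑' k : ι → ℤ, ∫ x in unitCube ι, g (x + intVec k) := by
  have : VAddInvariantMeasure (Submodule.span ℤ (Set.range (Pi.basisFun ℝ ι))) (ι → ℝ) volume :=
    ⟨fun c s _ => measure_preimage_add volume (c : ι → ℝ) s⟩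
  rw [(ZSpan.isAddFundamentalDomain (Pi.basisFun ℝ ι) volume).integral_eq_tsum'' g hg,
    ← (latticeEquiv (Pi.basisFun ℝ ι)).tsum_eq]
  refine tsum_congr fun k => ?_
  rw [setIntegral_congr_set unitCube_ae_eq_fundamentalDomain]
  simp only [Submodule.vadd_def, coe_latticeEquiv_basisFun, vadd_eq_add, add_comm]

variable {r : ℕ} {f : (ι → ℝ) → ℂ}

namespace Decays

theorem continuous_periodization (hf : Decays r f) (hr : Fintype.card ι < r) :
    Continuous (periodization f) := by
  refine continuous_iff_continuousAt.2 fun x => ?_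
  obtain ⟨C, -, hle⟩ := hf.exists_norm_add_le (R := ‖x‖ + 1) (by positivity)
  refine (continuousOn_tsum (s := Metric.ball 0 (‖x‖ + 1)) (fun k => ?_)
    ((summable_decayWeight_intVec hr).mul_left C) fun k y hy => ?_).continuousAt
    (Metric.isOpen_ball.mem_nhds (by simp))
  · exact (hf.continuous.comp (continuous_id.add continuous_const)).continuousOn
  · exact hle y _ (by simpa using (Metric.mem_ball.1 hy).le)

theorem setIntegral_unitCube_periodization (hf : Decays r f) (hr : Fintype.card ι < r) :
    ∫ x in unitCube ι, periodization f x = ∫ x, f x := by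
  have hint : Integrable f := hf.integrable (by simpa using hr)
  obtain ⟨C, -, hle⟩ := hf.exists_norm_add_le zero_le_one
  rw [integral_eq_tsum_setIntegral_unitCube hint]
  refine (integral_tsum_of_summable_integral_norm
    (fun k => (hint.comp_add_right _).integrableOn) ?_).symm
  refine Summable.of_nonneg_of_le (fun k => integral_nonneg fun _ => norm_nonneg _) (fun k => ?_)
    (((summable_decayWeight_intVec hr).mul_left C).mul_right (volume.real (unitCube ι)))
  refine (Real.le_norm_self _).trans
    (norm_setIntegral_le_of_norm_le_const volume_unitCube_lt_top fun x hx => ?_)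
  rw [norm_norm]
  exact hle x _ (norm_le_one_of_mem_unitCube hx)

theorem exists_continuousMap_toTorus_eq_periodization (hf : Decays r f)
    (hr : Fintype.card ι < r) :
    ∃ Q : C(UnitAddTorus ι, ℂ), ∀ x, Q (toTorus x) = periodization f x := by
  let P : C(ι → ℝ, ℂ) := ⟨periodization f, hf.continuous_periodization hr⟩
  have hP : Function.FactorsThrough P (toTorus (ι := ι)) := by
    intro x y hxy
    obtain ⟨l, rfl⟩ := exists_eq_add_intVec hxy
    exact (periodization_add_intVec f x l).symm
  exact ⟨isQuotientMap_toTorus.lift P hP,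
    fun x => congrArg (fun g : C(ι → ℝ, ℂ) => g x) (isQuotientMap_toTorus.lift_comp P hP)⟩

end Decays

theorem mFourier_toTorus (l : ι → ℤ) (x : ι → ℝ) :
    UnitAddTorus.mFourier l (toTorus x) = (𝐞 (x ⬝ᵥ intVec l) : ℂ) := by
  simp only [UnitAddTorus.mFourier, toTorus, ContinuousMap.coe_mk, fourier_coe_apply,
    Real.fourierChar_apply, dotProduct, intVec]
  rw [← Complex.exp_sum]
  congr 1
  push_cast
  rw [Finset.mul_sum, Finset.sum_mul]
  exact Finset.sum_congr rfl fun i _ => by ring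

theorem mFourier_toTorus_add_intVec (l k : ι → ℤ) (x : ι → ℝ) :
    UnitAddTorus.mFourier l (toTorus (x + intVec k)) = UnitAddTorus.mFourier l (toTorus x) := by
  congr 1
  ext i
  simp [toTorus, intVec]

theorem mFourierCoeff_eq_integral_of_eq_periodization (hf : Decays r f) (hr : Fintype.card ι < r)
    {Q : C(UnitAddTorus ι, ℂ)} (hQ : ∀ x, Q (toTorus x) = periodization f x) (l : ι → ℤ) :
    UnitAddTorus.mFourierCoeff Q l = ∫ x, 𝐞 (-(x ⬝ᵥ intVec l)) • f x := by
  have hchar (x : ι → ℝ) :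
      UnitAddTorus.mFourier (-l) (toTorus x) = (𝐞 (-(x ⬝ᵥ intVec l)) : ℂ) := by
    rw [mFourier_toTorus, ← dotProduct_neg]
    congr 3
    ext i
    simp [intVec]
  have hdec : Decays r fun x => UnitAddTorus.mFourier (-l) (toTorus x) * f x := by
    refine hf.mul_of_norm_le_one
      ((UnitAddTorus.mFourier (-l)).continuous.comp toTorus.continuous) fun x => ?_
    rw [hchar, Circle.norm_coe]
  simp_rw [Circle.smul_def, ← hchar, smul_eq_mul]
  rw [← hdec.setIntegral_unitCube_periodization hr, UnitAddTorus.mFourierCoeff_eq_integral Q l 0]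
  refine integral_congr_ae (ae_of_all _ fun x => ?_)
  change UnitAddTorus.mFourier (-l) (toTorus x) • Q (toTorus x) = _
  rw [hQ, smul_eq_mul, periodization, ← tsum_mul_left]
  exact tsum_congr fun k => by simp only [mFourier_toTorus_add_intVec]

theorem tsum_intVec_eq_tsum_integral (hf : Decays r f) (hr : Fintype.card ι < r)
    (hsum : Summable fun l : ι → ℤ => ∫ x, 𝐞 (-(x ⬝ᵥ intVec l)) • f x) :
    ∑' k : ι → ℤ, f (intVec k) = ∑' l : ι → ℤ, ∫ x, 𝐞 (-(x ⬝ᵥ intVec l)) • f x := by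
  obtain ⟨Q, hQ⟩ := hf.exists_continuousMap_toTorus_eq_periodization hr
  have hcoeff := mFourierCoeff_eq_integral_of_eq_periodization hf hr hQ
  have hseries := (UnitAddTorus.hasSum_mFourier_series_apply_of_summable
    (by simpa only [← hcoeff] using hsum) (toTorus 0)).tsum_eq
  rw [hQ, periodization] at hseries
  simpa [hcoeff, mFourier_toTorus] using hseries.symm

end IntegerLattice

section DualLattice

variable {E : Type*} [NormedAddCommGroup E] [NormedSpace ℝ E]

section Basis

variable {ι : Type*}

theorem equivFun_equivFunL_symm [Finite ι] (b : Module.Basis ι ℝ E) (x : ι → ℝ) :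
    b.equivFun (b.equivFunL.symm x) = x :=
  b.equivFun.apply_symm_apply x

variable [Fintype ι] (b : Module.Basis ι ℝ E)

variable [FiniteDimensional ℝ E] [MeasurableSpace E] [BorelSpace E] (μ : Measure E)
  [μ.IsAddHaarMeasure]

theorem map_equivFunL_symm_volume :
    (volume : Measure (ι → ℝ)).map b.equivFunL.symm =
      (μ (ZSpan.fundamentalDomain b))⁻¹ • μ := by
  have := b.equivFunL.symm.isAddHaarMeasure_map (volume : Measure (ι → ℝ))
  have hpre : b.equivFunL.symm ⁻¹' ZSpan.fundamentalDomain b =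
      ZSpan.fundamentalDomain (Pi.basisFun ℝ ι) := by
    ext x
    simp [ZSpan.mem_fundamentalDomain, ← Module.Basis.equivFun_apply, equivFun_equivFunL_symm]
  have hone : (volume : Measure (ι → ℝ)).map b.equivFunL.symm (ZSpan.fundamentalDomain b) = 1 := by
    rw [Measure.map_apply b.equivFunL.symm.continuous.measurable
      (ZSpan.fundamentalDomain_measurableSet b), hpre, ZSpan.fundamentalDomain_pi_basisFun,
      Real.volume_pi_Ico]
    simp
  have hsmul := Measure.isAddLeftInvariant_eq_smul
    ((volume : Measure (ι → ℝ)).map b.equivFunL.symm) μ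
  rw [hsmul, Measure.smul_apply, ENNReal.smul_def, smul_eq_mul] at hone
  rw [hsmul, ← ENNReal.eq_inv_of_mul_eq_one_left hone]
  rfl

theorem integral_comp_equivFunL_symm (g : E → ℂ) :
    ∫ x, g (b.equivFunL.symm x) =
      (ZLattice.covolume (Submodule.span ℤ (Set.range b)) μ : ℂ)⁻¹ * ∫ z, g z ∂μ := by
  have hmap : ∫ z, g z ∂(volume : Measure (ι → ℝ)).map b.equivFunL.symm =
      ∫ x, g (b.equivFunL.symm x) :=
    b.equivFunL.symm.toHomeomorph.measurableEmbedding.integral_map g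
  rw [← hmap, map_equivFunL_symm_volume b μ, integral_smul_measure,
    ZLattice.covolume_eq_measure_fundamentalDomain _ μ (ZSpan.isAddFundamentalDomain b μ),
    ENNReal.toReal_inv, ← Complex.ofReal_inv]
  rfl

theorem Decays.tsum_span_eq_tsum_integral {r : ℕ} {f : E → ℂ} (hf : Decays r f)
    (hr : Module.finrank ℝ E < r)
    (hsum : Summable fun l : ι → ℤ => ∫ z, 𝐞 (-(b.equivFun z ⬝ᵥ intVec l)) • f z ∂μ) :
    ∑' x : Submodule.span ℤ (Set.range b), f x =
      (ZLattice.covolume (Submodule.span ℤ (Set.range b)) μ : ℂ)⁻¹ *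
        ∑' l : ι → ℤ, ∫ z, 𝐞 (-(b.equivFun z ⬝ᵥ intVec l)) • f z ∂μ := by
  have hcoeff (l : ι → ℤ) : ∫ x, 𝐞 (-(x ⬝ᵥ intVec l)) • f (b.equivFunL.symm x) =
      (ZLattice.covolume (Submodule.span ℤ (Set.range b)) μ : ℂ)⁻¹ *
        ∫ z, 𝐞 (-(b.equivFun z ⬝ᵥ intVec l)) • f z ∂μ := by
    rw [← integral_comp_equivFunL_symm b μ]
    simp only [equivFun_equivFunL_symm]
  have key := tsum_intVec_eq_tsum_integral (hf.comp_continuousLinearEquiv b.equivFunL.symm)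
    (by rwa [← Module.finrank_eq_card_basis b]) (by simpa only [hcoeff] using hsum.mul_left _)
  simp only [hcoeff] at key
  rw [← (latticeEquiv b).tsum_eq, ← tsum_mul_left]
  simp only [coe_latticeEquiv]
  exact key

end Basis

variable [FiniteDimensional ℝ E] {B : LinearMap.BilinForm ℝ E}
  (hB : B.Nondegenerate) (L : Submodule ℤ E) [DiscreteTopology L] [IsZLattice ℝ L]

/-- A real basis of `E` generating the lattice `L` over `ℤ`. -/
noncomputable def latticeBasis : Module.Basis (Module.Free.ChooseBasisIndex ℤ L) ℝ E :=
  (Module.Free.chooseBasis ℤ L).ofZLatticeBasis ℝ L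

/-- The basis dual to `latticeBasis L` with respect to `B`, generating the dual lattice. -/
noncomputable def dualLatticeBasis : Module.Basis (Module.Free.ChooseBasisIndex ℤ L) ℝ E :=
  open scoped Classical in B.dualBasis hB (latticeBasis L)

theorem dualLatticeBasis_repr_apply (x : E) (i) :
    (dualLatticeBasis hB L).repr x i = B x (latticeBasis L i) := by
  classical exact LinearMap.BilinForm.dualBasis_repr_apply hB (latticeBasis L) x i

theorem dualSubmodule_eq_span_dualLatticeBasis :
    B.dualSubmodule L = Submodule.span ℤ (Set.range (dualLatticeBasis hB L)) := by
  classical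
  conv_lhs => rw [← (Module.Free.chooseBasis ℤ L).ofZLatticeBasis_span ℝ]
  exact B.dualSubmodule_span_of_basis hB (latticeBasis L)

include hB in
theorem discreteTopology_dualSubmodule : DiscreteTopology (B.dualSubmodule L) := by
  rw [dualSubmodule_eq_span_dualLatticeBasis hB L]
  infer_instance

include hB in
theorem isZLattice_dualSubmodule [DiscreteTopology (B.dualSubmodule L)] :
    IsZLattice ℝ (B.dualSubmodule L) where
  span_top := by
    rw [dualSubmodule_eq_span_dualLatticeBasis hB L]
    exact ZSpan.span_top _

theorem dualLatticeBasis_equivFun_dotProduct_intVec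
    (z : E) (l : Module.Free.ChooseBasisIndex ℤ L → ℤ) :
    (dualLatticeBasis hB L).equivFun z ⬝ᵥ intVec l =
      B z ((Module.Free.chooseBasis ℤ L).equivFun.symm l) := by
  simp [Module.Basis.equivFun_symm_apply, latticeBasis, intVec, dotProduct,
    dualLatticeBasis_repr_apply, mul_comm]

variable [MeasurableSpace E] [BorelSpace E] (μ : Measure E) [μ.IsAddHaarMeasure]

include hB in
theorem Decays.tsum_dualSubmodule_eq_tsum_fourierIntegral {r : ℕ} {f : E → ℂ} (hf : Decays r f)
    (hr : Module.finrank ℝ E < r)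
    (hsum : Summable fun x : L => VectorFourier.fourierIntegral 𝐞 μ B f x) :
    ∑' y : B.dualSubmodule L, f y = (ZLattice.covolume (B.dualSubmodule L) μ : ℂ)⁻¹ *
      ∑' x : L, VectorFourier.fourierIntegral 𝐞 μ B f x := by
  have key := hf.tsum_span_eq_tsum_integral (dualLatticeBasis hB L) μ hr
  simp only [dualLatticeBasis_equivFun_dotProduct_intVec] at key
  rw [dualSubmodule_eq_span_dualLatticeBasis hB L,
    key ((Module.Free.chooseBasis ℤ L).equivFun.symm.toEquiv.summable_iff.2 hsum),
    ← (Module.Free.chooseBasis ℤ L).equivFun.symm.toEquiv.tsum_eq]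
  rfl

end DualLattice

section Product

variable {n m : ℕ}

/-- The Euclidean inner product on the product space, whose dual submodules are the dual lattices
of the statement. -/
noncomputable def pairing : LinearMap.BilinForm ℝ (Euc n × Euc m) :=
  (innerₗ (Euc n)).compl₁₂ (.fst ℝ _ _) (.fst ℝ _ _) +
    (innerₗ (Euc m)).compl₁₂ (.snd ℝ _ _) (.snd ℝ _ _)

theorem pairing_apply (x y : Euc n × Euc m) :
    pairing x y = inner ℝ x.1 y.1 + inner ℝ x.2 y.2 := rfl

theorem isSymm_pairing : (pairing (n := n) (m := m)).IsSymm :=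
  ⟨fun x y => by simp [pairing_apply, real_inner_comm]⟩

theorem nondegenerate_pairing : (pairing (n := n) (m := m)).Nondegenerate := by
  refine (isSymm_pairing.isRefl.nondegenerate_iff_separatingLeft).2 fun x hx => ?_
  have hself := hx x
  rw [pairing_apply] at hself
  have hfst := real_inner_self_nonneg (x := x.1)
  have hsnd := real_inner_self_nonneg (x := x.2)
  exact Prod.ext (inner_self_eq_zero (𝕜 := ℝ).1 (by linarith))
    (inner_self_eq_zero (𝕜 := ℝ).1 (by linarith))

theorem dualLattice_eq_dualSubmodule (Γ : Submodule ℤ (Euc n × Euc m)) :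
    dualLattice Γ = pairing.dualSubmodule Γ := by
  ext y
  change (∀ x ∈ Γ, ∃ k : ℤ, pairing x y = k) ↔ _
  simp [LinearMap.BilinForm.mem_dualSubmodule, Submodule.mem_one, isSymm_pairing.eq y, eq_comm]

instance isAddHaarMeasure_volume_prod :
    (volume : Measure (Euc n × Euc m)).IsAddHaarMeasure :=
  Measure.prod.instIsAddHaarMeasure _ _

variable (Γ : Submodule ℤ (Euc n × Euc m)) [DiscreteTopology Γ] [IsZLattice ℝ Γ]

instance discreteTopology_dualLattice : DiscreteTopology (dualLattice Γ) := by
  rw [dualLattice_eq_dualSubmodule]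
  exact discreteTopology_dualSubmodule nondegenerate_pairing Γ

instance isZLattice_dualLattice : IsZLattice ℝ (dualLattice Γ) := by
  have := discreteTopology_dualSubmodule nondegenerate_pairing Γ
  have := isZLattice_dualSubmodule nondegenerate_pairing Γ
  exact ⟨by rw [dualLattice_eq_dualSubmodule, this.span_top]⟩

/-- The number of points of the dual lattice per unit volume. -/
noncomputable def dualDensity : ℝ := (ZLattice.covolume (dualLattice Γ))⁻¹

theorem dualDensity_pos : 0 < dualDensity Γ := inv_pos.2 (ZLattice.covolume_pos _ _)

theorem fourierIntegral_pairing_mul (K : Euc n → ℂ) (w : Euc m → ℂ) (y : Euc n × Euc m) :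
    VectorFourier.fourierIntegral 𝐞 volume pairing (fun z => K z.1 * w z.2) y =
      𝓕 K y.1 * 𝓕 w y.2 := by
  rw [Real.fourier_eq, Real.fourier_eq, ← integral_prod_mul]
  refine integral_congr_ae (ae_of_all _ fun z => ?_)
  simp only [pairing_apply, neg_add, AddChar.map_add_eq_mul, Circle.smul_def, Circle.coe_mul,
    smul_eq_mul]
  ring

theorem tsum_dualLattice_mul_eq_tsum_fourier_mul {r : ℕ} {K : Euc n → ℂ} {w : Euc m → ℂ}
    (hr : n + m < r) (hK : Decays r K) (hw : Decays r w) (hK' : Decays r (𝓕 K))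
    (hw' : Decays r (𝓕 w)) :
    ∑' y : dualLattice Γ, K (y : Euc n × Euc m).1 * w (y : Euc n × Euc m).2 =
      dualDensity Γ * ∑' x : Γ, 𝓕 K (x : Euc n × Euc m).1 * 𝓕 w (x : Euc n × Euc m).2 := by
  have hr' : Module.finrank ℝ (Euc n × Euc m) < r := by simpa using hr
  have key := (hK.prod_mul hw).tsum_dualSubmodule_eq_tsum_fourierIntegral nondegenerate_pairing Γ
    volume hr' (by simpa only [fourierIntegral_pairing_mul] using (hK'.prod_mul hw').summable hr' Γ)
  rw [dualDensity, Complex.ofReal_inv, dualLattice_eq_dualSubmodule]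
  simpa only [fourierIntegral_pairing_mul] using key

end Product

/-! ### Frames and Riesz sequences in Hilbert spaces -/

section HilbertSystems

variable {ι H : Type*} [NormedAddCommGroup H] [InnerProductSpace ℂ H] {f : ι → H} {A B : ℝ}

theorem norm_sq_lp_two (a : lp (fun _ : ι => ℂ) 2) : ‖a‖ ^ 2 = ∑' i, ‖a i‖ ^ 2 := by
  simpa using lp.norm_rpow_eq_tsum (p := 2) (by norm_num) a

theorem memℓp_two_iff {a : ι → ℂ} : Memℓp a 2 ↔ Summable fun i => ‖a i‖ ^ 2 := by
  rw [memℓp_gen_iff (by norm_num)]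
  simp

/-- `f` is a Bessel system with bound `B`. -/
structure IsBessel (B : ℝ) (f : ι → H) : Prop where
  nonneg : 0 ≤ B
  sum_le : ∀ (s : Finset ι) (x : H), ∑ i ∈ s, ‖(inner ℂ (f i) x : ℂ)‖ ^ 2 ≤ B * ‖x‖ ^ 2

/-- `f` satisfies the frame inequalities with bounds `A` and `B`. -/
def FrameBounds (A B : ℝ) (f : ι → H) : Prop :=
  ∀ x : H, Summable (fun i => ‖(inner ℂ (f i) x : ℂ)‖ ^ 2) ∧
    A * ‖x‖ ^ 2 ≤ ∑' i, ‖(inner ℂ (f i) x : ℂ)‖ ^ 2 ∧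
    ∑' i, ‖(inner ℂ (f i) x : ℂ)‖ ^ 2 ≤ B * ‖x‖ ^ 2

/-- `f` satisfies the Riesz sequence inequalities with bounds `A` and `B`. -/
def RieszBounds (A B : ℝ) (f : ι → H) : Prop :=
  ∀ (s : Finset ι) (c : ι → ℂ),
    A * ∑ i ∈ s, ‖c i‖ ^ 2 ≤ ‖∑ i ∈ s, c i • f i‖ ^ 2 ∧
    ‖∑ i ∈ s, c i • f i‖ ^ 2 ≤ B * ∑ i ∈ s, ‖c i‖ ^ 2

namespace IsBessel

theorem summable (hf : IsBessel B f) (x : H) :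
    Summable fun i => ‖(inner ℂ (f i) x : ℂ)‖ ^ 2 :=
  summable_of_sum_le (fun _ => by positivity) fun s => hf.sum_le s x

theorem tsum_le (hf : IsBessel B f) (x : H) :
    ∑' i, ‖(inner ℂ (f i) x : ℂ)‖ ^ 2 ≤ B * ‖x‖ ^ 2 :=
  (hf.summable x).tsum_le_of_sum_le fun s => hf.sum_le s x

/-- The analysis operator `x ↦ (⟨x, fᵢ⟩)ᵢ` of a Bessel system. -/
noncomputable def analysis (hf : IsBessel B f) : H →L[ℂ] lp (fun _ : ι => ℂ) 2 :=
  LinearMap.mkContinuous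
    { toFun := fun x => ⟨fun i => inner ℂ (f i) x, memℓp_two_iff.2 (hf.summable x)⟩
      map_add' := fun x y => by ext i; exact inner_add_right _ _ _
      map_smul' := fun c x => by ext i; exact inner_smul_right _ _ _ }
    √B fun x => by
      refine le_of_sq_le_sq ?_ (by positivity)
      rw [mul_pow, Real.sq_sqrt hf.nonneg, norm_sq_lp_two]
      exact hf.tsum_le x

theorem analysis_apply (hf : IsBessel B f) (x : H) (i : ι) : hf.analysis x i = inner ℂ (f i) x :=
  rfl

theorem norm_analysis_sq (hf : IsBessel B f) (x : H) :
    ‖hf.analysis x‖ ^ 2 = ∑' i, ‖(inner ℂ (f i) x : ℂ)‖ ^ 2 :=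
  norm_sq_lp_two _

theorem of_dense {D : Set H} (hD : Dense D) (hB : 0 ≤ B)
    (h : ∀ x ∈ D, ∀ s : Finset ι, ∑ i ∈ s, ‖(inner ℂ (f i) x : ℂ)‖ ^ 2 ≤ B * ‖x‖ ^ 2) :
    IsBessel B f :=
  ⟨hB, fun s x => hD.induction (P := fun x => ∑ i ∈ s, ‖(inner ℂ (f i) x : ℂ)‖ ^ 2 ≤ B * ‖x‖ ^ 2)
    (fun x hx => h x hx s) (isClosed_le (by fun_prop) (by fun_prop)) x⟩

theorem frameBounds (hf : IsBessel B f) (h : ∀ x, A * ‖x‖ ^ 2 ≤ ‖hf.analysis x‖ ^ 2) :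
    FrameBounds A B f :=
  fun x => ⟨hf.summable x, hf.norm_analysis_sq x ▸ h x, hf.tsum_le x⟩

variable [CompleteSpace H]

theorem adjoint_analysis_single [DecidableEq ι] (hf : IsBessel B f) (i : ι) (c : ℂ) :
    hf.analysis.adjoint (lp.single 2 i c) = c • f i := by
  refine ext_inner_right ℂ fun y => ?_
  rw [ContinuousLinearMap.adjoint_inner_left, lp.inner_single_left, analysis_apply,
    inner_smul_left, RCLike.inner_apply', mul_comm]

theorem hasSum_adjoint_analysis (hf : IsBessel B f) (a : lp (fun _ : ι => ℂ) 2) :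
    HasSum (fun i => a i • f i) (hf.analysis.adjoint a) := by
  classical
  simpa only [Function.comp_def, adjoint_analysis_single] using
    hf.analysis.adjoint.hasSum (lp.hasSum_single (p := 2) (by norm_num) a)

end IsBessel

theorem FrameBounds.of_dense {D : Set H} (hD : Dense D) (hB : 0 ≤ B)
    (h : ∀ x ∈ D, Summable (fun i => ‖(inner ℂ (f i) x : ℂ)‖ ^ 2) ∧
      A * ‖x‖ ^ 2 ≤ ∑' i, ‖(inner ℂ (f i) x : ℂ)‖ ^ 2 ∧
      ∑' i, ‖(inner ℂ (f i) x : ℂ)‖ ^ 2 ≤ B * ‖x‖ ^ 2) : FrameBounds A B f := by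
  have hbessel : IsBessel B f := .of_dense hD hB fun x hx s =>
    ((h x hx).1.sum_le_tsum s fun _ _ => by positivity).trans (h x hx).2.2
  refine hbessel.frameBounds fun x => ?_
  refine hD.induction (P := fun x => A * ‖x‖ ^ 2 ≤ ‖hbessel.analysis x‖ ^ 2) (fun x hx => ?_)
    (isClosed_le (by fun_prop) (by fun_prop)) x
  rw [hbessel.norm_analysis_sq]
  exact (h x hx).2.1

theorem frameBounds_comp_equiv {κ : Type*} (e : κ ≃ ι) :
    FrameBounds A B (f ∘ e) ↔ FrameBounds A B f :=
  forall_congr' fun x => by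
    rw [← e.summable_iff, ← e.tsum_eq]
    rfl

namespace RieszBounds

theorem comp_injective {κ : Type*} (hf : RieszBounds A B f) {e : κ → ι}
    (he : Function.Injective e) : RieszBounds A B (f ∘ e) := fun s c => by
  have h := hf (s.map ⟨e, he⟩) (Function.extend e c 0)
  simpa [he.extend_apply] using h

theorem isBessel (hf : RieszBounds A B f) (hB : 0 ≤ B) : IsBessel B f := by
  refine ⟨hB, fun s x => ?_⟩
  set S := ∑ i ∈ s, ‖(inner ℂ (f i) x : ℂ)‖ ^ 2 with hS
  set y := ∑ i ∈ s, (inner ℂ (f i) x : ℂ) • f i with hy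
  have hS0 : 0 ≤ S := Finset.sum_nonneg fun _ _ => by positivity
  have hinner : inner ℂ y x = (S : ℂ) := by
    rw [hy, sum_inner, hS]
    push_cast
    exact Finset.sum_congr rfl fun i _ => by rw [inner_smul_left, Complex.conj_mul']
  have hcauchy : S ≤ ‖y‖ * ‖x‖ := by
    simpa [hinner, abs_of_nonneg hS0] using norm_inner_le_norm (𝕜 := ℂ) y x
  have hsq : S ^ 2 ≤ B * S * ‖x‖ ^ 2 :=
    calc S ^ 2 ≤ (‖y‖ * ‖x‖) ^ 2 := by gcongr
      _ = ‖y‖ ^ 2 * ‖x‖ ^ 2 := by ring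
      _ ≤ B * S * ‖x‖ ^ 2 := by gcongr; exact (hf s _).2
  rcases hS0.eq_or_lt with h0 | h0
  · rw [← h0]
    positivity
  · nlinarith

theorem of_hasSum (hf : RieszBounds A B f) {c : ι → ℂ} {x : H}
    (hx : HasSum (fun i => c i • f i) x) (hc : Summable fun i => ‖c i‖ ^ 2) :
    A * ∑' i, ‖c i‖ ^ 2 ≤ ‖x‖ ^ 2 ∧ ‖x‖ ^ 2 ≤ B * ∑' i, ‖c i‖ ^ 2 := by
  have hnorm : Tendsto (fun s : Finset ι => ‖∑ i ∈ s, c i • f i‖ ^ 2) atTop (𝓝 (‖x‖ ^ 2)) :=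
    (Filter.Tendsto.norm hx).pow 2
  exact ⟨le_of_tendsto_of_tendsto' (Tendsto.const_mul A hc.hasSum) hnorm fun s => (hf s c).1,
    le_of_tendsto_of_tendsto' hnorm (Tendsto.const_mul B hc.hasSum) fun s => (hf s c).2⟩

theorem eq_zero_of_hasSum_zero (hf : RieszBounds A B f) (hA : 0 < A) {c : ι → ℂ}
    (hc : HasSum (fun i => c i • f i) 0) : c = 0 := by
  have hnorm : Tendsto (fun s : Finset ι => ‖∑ i ∈ s, c i • f i‖ ^ 2) atTop (𝓝 0) := by
    simpa using (Filter.Tendsto.norm hc).pow 2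
  funext i
  have hi : A * ‖c i‖ ^ 2 ≤ 0 := by
    refine ge_of_tendsto hnorm ?_
    filter_upwards [eventually_ge_atTop {i}] with s hs
    refine le_trans ?_ (hf s c).1
    gcongr
    exact Finset.single_le_sum (f := fun i => ‖c i‖ ^ 2) (fun _ _ => by positivity)
      (Finset.singleton_subset_iff.1 hs)
  have hzero : ‖c i‖ ^ 2 = 0 :=
    le_antisymm (nonpos_of_mul_nonpos_right hi hA) (by positivity)
  simpa using hzero

variable [CompleteSpace H]

theorem isClosed_range_adjoint_analysis (hf : RieszBounds A B f) (hA : 0 < A)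
    (hbessel : IsBessel B f) : IsClosed (Set.range hbessel.analysis.adjoint) := by
  have hanti : AntilipschitzWith ⟨(√A)⁻¹, by positivity⟩ hbessel.analysis.adjoint := by
    refine ContinuousLinearMap.antilipschitz_of_bound _ fun a => ?_
    change ‖a‖ ≤ (√A)⁻¹ * ‖hbessel.analysis.adjoint a‖
    rw [le_inv_mul_iff₀ (Real.sqrt_pos.2 hA)]
    refine le_of_sq_le_sq ?_ (norm_nonneg _)
    rw [mul_pow, Real.sq_sqrt hA.le, norm_sq_lp_two]
    exact (hf.of_hasSum (hbessel.hasSum_adjoint_analysis a) (memℓp_two_iff.1 (lp.memℓp a))).1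
  exact hanti.isClosed_range hbessel.analysis.adjoint.uniformContinuous

end RieszBounds

theorem rieszBounds_comp_equiv {κ : Type*} (e : κ ≃ ι) :
    RieszBounds A B (f ∘ e) ↔ RieszBounds A B f :=
  ⟨fun h => by simpa [Function.comp_assoc] using h.comp_injective e.symm.injective,
    fun h => h.comp_injective e.injective⟩

theorem FrameBounds.ker_analysis {B' : ℝ} (hf : FrameBounds A B f) (hA : 0 < A)
    (hbessel : IsBessel B' f) : hbessel.analysis.ker = ⊥ := by
  refine LinearMap.ker_eq_bot'.2 fun x hx => ?_
  have hlower := (hf x).2.1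
  rw [← hbessel.norm_analysis_sq, show hbessel.analysis x = 0 from hx] at hlower
  have hzero : ‖x‖ ^ 2 ≤ 0 := nonpos_of_mul_nonpos_right (by simpa using hlower) hA
  simpa using hzero

theorem IsRieszBasis.isRieszSequence (h : IsRieszBasis f) : IsRieszSequence f := by
  classical
  obtain ⟨A, B, hA, hB, h⟩ := h
  refine ⟨B⁻¹, A⁻¹, by positivity, by positivity, fun s c => ?_⟩
  obtain ⟨d, -, huniq, -, hlower, hupper⟩ := h (∑ i ∈ s, c i • f i)
  have hsum : HasSum (fun i => (if i ∈ s then c i else 0) • f i) (∑ i ∈ s, c i • f i) := by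
    have hc : ∑ i ∈ s, (if i ∈ s then c i else 0) • f i = ∑ i ∈ s, c i • f i :=
      Finset.sum_congr rfl fun i hi => by rw [if_pos hi]
    rw [← hc]
    exact hasSum_sum_of_ne_finset_zero fun i hi => by simp [hi]
  have hnorm : ∑' i, ‖d i‖ ^ 2 = ∑ i ∈ s, ‖c i‖ ^ 2 := by
    rw [← huniq _ hsum, tsum_eq_sum (s := s) fun i hi => by simp [hi]]
    exact Finset.sum_congr rfl fun i hi => by simp [hi]
  rw [hnorm] at hlower hupper
  rw [inv_mul_le_iff₀ hB, le_inv_mul_iff₀ hA]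
  exact ⟨hupper, hlower⟩

variable [CompleteSpace H]

theorem IsRieszBasis.isFrame (h : IsRieszBasis f) : IsFrame f := by
  obtain ⟨_, B', -, hB', hRiesz⟩ := h.isRieszSequence
  have hbessel := RieszBounds.isBessel hRiesz hB'.le
  obtain ⟨_, B, -, hB, h⟩ := h
  refine ⟨B⁻¹, B', by positivity, hB', hbessel.frameBounds fun x => ?_⟩
  obtain ⟨c, hc, -, hc2, -, hle⟩ := h x
  set a : lp (fun _ : ι => ℂ) 2 := ⟨c, memℓp_two_iff.2 hc2⟩
  have hx : hbessel.analysis.adjoint a = x := (hbessel.hasSum_adjoint_analysis a).unique hc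
  have hcauchy : ‖x‖ ^ 2 ≤ ‖a‖ * ‖hbessel.analysis x‖ := by
    calc ‖x‖ ^ 2 = ‖(inner ℂ (hbessel.analysis.adjoint a) x : ℂ)‖ := by
          rw [hx, inner_self_eq_norm_sq_to_K, norm_pow, RCLike.norm_ofReal, abs_norm]
      _ ≤ ‖a‖ * ‖hbessel.analysis x‖ := by
          rw [ContinuousLinearMap.adjoint_inner_left]
          exact norm_inner_le_norm _ _
  have ha2 : ‖a‖ ^ 2 ≤ B * ‖x‖ ^ 2 := norm_sq_lp_two a ▸ hle
  rw [inv_mul_le_iff₀ hB]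
  rcases eq_or_ne x 0 with rfl | hx0
  · simp
  · have hpos : 0 < ‖x‖ ^ 2 := by positivity
    have hsq : (‖x‖ ^ 2) ^ 2 ≤ B * ‖x‖ ^ 2 * ‖hbessel.analysis x‖ ^ 2 :=
      calc (‖x‖ ^ 2) ^ 2 ≤ (‖a‖ * ‖hbessel.analysis x‖) ^ 2 := by gcongr
        _ = ‖a‖ ^ 2 * ‖hbessel.analysis x‖ ^ 2 := by ring
        _ ≤ B * ‖x‖ ^ 2 * ‖hbessel.analysis x‖ ^ 2 := by gcongr
    nlinarith

theorem IsRieszSequence.isRieszBasis (h : IsRieszSequence f) (hf : IsFrame f) :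
    IsRieszBasis f := by
  obtain ⟨A, B, hA, hB, hRiesz : RieszBounds A B f⟩ := h
  have hbessel := hRiesz.isBessel hB.le
  have hsurj : Function.Surjective hbessel.analysis.adjoint := by
    obtain ⟨_, _, hA', -, hFrame⟩ := hf
    have hdense : hbessel.analysis.adjoint.range.topologicalClosure = ⊤ := by
      rw [Submodule.topologicalClosure_eq_top_iff, ContinuousLinearMap.orthogonal_range,
        ContinuousLinearMap.adjoint_adjoint]
      exact FrameBounds.ker_analysis hFrame hA' hbessel
    rw [IsClosed.submodule_topologicalClosure_eq
      (hRiesz.isClosed_range_adjoint_analysis hA hbessel)] at hdense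
    exact LinearMap.range_eq_top.1 hdense
  refine ⟨B⁻¹, A⁻¹, by positivity, by positivity, fun x => ?_⟩
  obtain ⟨a, rfl⟩ := hsurj x
  have hsum := hbessel.hasSum_adjoint_analysis a
  have ha := memℓp_two_iff.1 (lp.memℓp a)
  refine ⟨a, hsum, fun c hc => ?_, ha, ?_, ?_⟩
  · exact sub_eq_zero.1 <| hRiesz.eq_zero_of_hasSum_zero hA <| by
      simpa only [Pi.sub_apply, sub_smul, sub_self] using hc.sub hsum
  · exact (inv_mul_le_iff₀ hB).2 (hRiesz.of_hasSum hsum ha).2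
  · exact (le_inv_mul_iff₀ hA).2 (hRiesz.of_hasSum hsum ha).1

theorem tendsto_norm_sq_tsum_of_tendsto_inner_zero {α : Type*} {l : Filter α} {g : α → ι → H}
    {u L : ι → ℝ} (hu : Summable u) (hg : ∀ᶠ a in l, ∀ i, ‖g a i‖ ≤ u i)
    (horth : ∀ i j, i ≠ j → Tendsto (fun a => (inner ℂ (g a i) (g a j) : ℂ)) l (𝓝 0))
    (hnorm : ∀ i, Tendsto (fun a => ‖g a i‖ ^ 2) l (𝓝 (L i))) :
    Tendsto (fun a => ‖∑' i, g a i‖ ^ 2) l (𝓝 (∑' i, L i)) := by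
  classical
  rcases l.eq_or_neBot with rfl | hl
  · exact tendsto_bot
  have hu0 (i : ι) : 0 ≤ u i := by
    obtain ⟨a, ha⟩ := hg.exists
    exact (norm_nonneg _).trans (ha i)
  have hexpand : ∀ᶠ a in l, ∑' i, ∑' j, (inner ℂ (g a i) (g a j) : ℂ) =
      ((‖∑' i, g a i‖ ^ 2 : ℝ) : ℂ) := by
    filter_upwards [hg] with a ha
    have hsum : Summable (g a) := hu.of_norm_bounded ha
    have hleft (y : H) : ∑' j, (inner ℂ y (g a j) : ℂ) = inner ℂ y (∑' j, g a j) :=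
      ((innerSL ℂ y).map_tsum hsum).symm
    have hright : ∑' i, (inner ℂ (g a i) (∑' j, g a j) : ℂ) =
        inner ℂ (∑' i, g a i) (∑' j, g a j) :=
      ((innerSLFlip ℂ (∑' j, g a j)).map_tsum hsum).symm
    simp_rw [hleft, hright, inner_self_eq_norm_sq_to_K]
    norm_cast
  have hbound : ∀ᶠ a in l, ∀ i j, ‖(inner ℂ (g a i) (g a j) : ℂ)‖ ≤ u i * u j := by
    filter_upwards [hg] with a ha i j
    exact (norm_inner_le_norm _ _).trans
      (mul_le_mul (ha i) (ha j) (norm_nonneg _) (hu0 i))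
  have hrow (i : ι) : Tendsto (fun a => ∑' j, (inner ℂ (g a i) (g a j) : ℂ)) l (𝓝 (L i : ℂ)) := by
    rw [← tsum_ite_eq i fun _ => (L i : ℂ)]
    refine tendsto_tsum_of_dominated_convergence (hu.mul_left (u i)) (fun j => ?_)
      (hbound.mono fun a ha j => ha i j)
    split_ifs with hij
    · subst hij
      simp_rw [inner_self_eq_norm_sq_to_K]
      exact_mod_cast (Complex.continuous_ofReal.tendsto _).comp (hnorm j)
    · exact horth i j (Ne.symm hij)
  have hlim : Tendsto (fun a => ((‖∑' i, g a i‖ ^ 2 : ℝ) : ℂ)) l (𝓝 ((∑' i, L i : ℝ) : ℂ)) := by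
    rw [Complex.ofReal_tsum]
    refine (tendsto_tsum_of_dominated_convergence (hu.mul_right (∑' j, u j)) hrow ?_).congr'
      hexpand
    filter_upwards [hbound] with a ha i
    rw [← tsum_mul_left]
    exact tsum_of_norm_bounded (hu.mul_left (u i)).hasSum (ha i)
  exact tendsto_ofReal_iff.1 hlim

end HilbertSystems

/-! ### Rescaled bumps and equidistribution -/

section Bumps

variable {n m : ℕ}

theorem decays_schwartz {E : Type*} [NormedAddCommGroup E] [NormedSpace ℝ E] (r : ℕ)
    (f : 𝓢(E, ℂ)) : Decays r f := by
  refine ⟨f.continuous, 2 ^ r * ((Finset.Iic (r, 0)).sup fun m : ℕ × ℕ =>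
    SchwartzMap.seminorm ℝ m.1 m.2) f, by positivity, fun x => ?_⟩
  have h := SchwartzMap.one_add_le_sup_seminorm_apply (𝕜 := ℝ) (m := (r, 0)) le_rfl le_rfl f x
  rwa [decayWeight, ← div_eq_mul_inv, le_div_iff₀ (by positivity), mul_comm,
    ← norm_iteratedFDeriv_zero (𝕜 := ℝ)]

theorem expFun_comm (x v : Euc m) : expFun x v = expFun v x := by
  rw [expFun, expFun, real_inner_comm]

theorem fourier_eq_integral_expFun_mul (f : Euc m → ℂ) (x : Euc m) :
    𝓕 f x = ∫ y, expFun (-x) y * f y := by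
  rw [Real.fourier_eq']
  refine integral_congr_ae (ae_of_all _ fun y => ?_)
  simp only [expFun, inner_neg_left, real_inner_comm x y, smul_eq_mul]
  push_cast
  ring_nf

/-- The function `φ` moved to the point `v` and rescaled to size `ε`, normalised so that its
`L²` norm does not depend on `ε > 0`. -/
noncomputable def bump (φ : Euc m → ℂ) (ε : ℝ) (v y : Euc m) : ℂ :=
  (√(ε ^ m))⁻¹ • φ (ε⁻¹ • (y - v))

theorem bump_inv_zero (φ : Euc m → ℂ) (ε : ℝ) (y : Euc m) :
    bump φ ε⁻¹ 0 y = √(ε ^ m) • φ (ε • y) := by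
  rw [bump, inv_inv, sub_zero, inv_pow, Real.sqrt_inv, inv_inv]

theorem continuous_bump {φ : Euc m → ℂ} (hφ : Continuous φ) (ε : ℝ) (v : Euc m) :
    Continuous (bump φ ε v) := by
  unfold bump
  fun_prop

variable {ε : ℝ}

theorem exists_schwartz_eq_bump (φ : 𝓢(Euc m, ℂ)) (hε : ε ≠ 0) (v : Euc m) :
    ∃ ψ : 𝓢(Euc m, ℂ), bump φ ε v = ψ :=
  ⟨(√(ε ^ m))⁻¹ • SchwartzMap.compSubConstCLM ℝ v (SchwartzMap.compCLMOfContinuousLinearEquiv ℝ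
    (ContinuousLinearEquiv.smulLeft (Units.mk0 ε⁻¹ (inv_ne_zero hε))) φ), by
    ext y; simp [bump, Units.smul_def, smul_sub]⟩

theorem integral_comp_inv_smul_sub {F : Type*} [NormedAddCommGroup F] [NormedSpace ℝ F]
    (hε : 0 < ε) (v : Euc m) (g : Euc m → F) :
    ∫ y, g (ε⁻¹ • (y - v)) = ε ^ m • ∫ y, g y := by
  rw [integral_sub_right_eq_self (fun y => g (ε⁻¹ • y)) v, Measure.integral_comp_inv_smul,
    finrank_euclideanSpace_fin, abs_of_pos (by positivity)]

theorem integral_norm_sq_bump (φ : Euc m → ℂ) (hε : 0 < ε) (v : Euc m) :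
    ∫ y, ‖bump φ ε v y‖ ^ 2 = ∫ y, ‖φ y‖ ^ 2 := by
  simp only [bump, norm_smul, mul_pow]
  rw [integral_const_mul, integral_comp_inv_smul_sub hε v (fun y => ‖φ y‖ ^ 2), norm_inv, inv_pow,
    Real.norm_of_nonneg (Real.sqrt_nonneg _), Real.sq_sqrt (by positivity), smul_eq_mul,
    inv_mul_cancel_left₀ (by positivity)]

theorem fourier_bump (φ : Euc m → ℂ) (hε : 0 < ε) (v x : Euc m) :
    𝓕 (bump φ ε v) x = √(ε ^ m) • (expFun (-x) v * 𝓕 φ (ε • x)) := by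
  have hpt : ∀ y, expFun (-x) y * bump φ ε v y =
      (√(ε ^ m))⁻¹ • (fun z => expFun (-x) v * (expFun (-(ε • x)) z * φ z)) (ε⁻¹ • (y - v)) := by
    intro y
    have hy : expFun (-x) y = expFun (-x) v * expFun (-(ε • x)) (ε⁻¹ • (y - v)) := by
      rw [expFun, expFun, expFun, ← Complex.exp_add, ← smul_neg, real_inner_smul_left,
        real_inner_smul_right, mul_inv_cancel_left₀ hε.ne', inner_sub_right]
      push_cast
      ring_nf
    rw [bump, hy, mul_smul_comm, mul_assoc]
  rw [fourier_eq_integral_expFun_mul, integral_congr_ae (ae_of_all _ hpt), integral_smul,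
    integral_comp_inv_smul_sub hε v (fun z => expFun (-x) v * (expFun (-(ε • x)) z * φ z)),
    integral_const_mul, ← fourier_eq_integral_expFun_mul,
    smul_smul, inv_mul_eq_div, Real.div_sqrt]

theorem exists_schwartz_fourier_eq_bump (φ : 𝓢(Euc m, ℂ)) (hε : 0 < ε) (z : Euc m) :
    ∃ w : 𝓢(Euc m, ℂ), (∀ y, w y = √(ε ^ m) • (expFun z y * 𝓕 (φ : Euc m → ℂ) (ε • y))) ∧
      ∀ x, 𝓕 (w : Euc m → ℂ) x = bump φ ε x z := by
  set φneg : 𝓢(Euc m, ℂ) :=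
    SchwartzMap.compCLMOfContinuousLinearEquiv ℝ (ContinuousLinearEquiv.neg ℝ) φ
  have hφneg : ∀ y, φneg y = φ (-y) := fun y => by simp [φneg]
  have h𝓕φneg : ∀ y, 𝓕 (φneg : Euc m → ℂ) (-y) = 𝓕 (φ : Euc m → ℂ) y := fun y => by
    rw [fourier_eq_integral_expFun_mul, fourier_eq_integral_expFun_mul, ← integral_neg_eq_self]
    simp only [hφneg, expFun, neg_neg, inner_neg_left, inner_neg_right]
  obtain ⟨ψ, hψ⟩ := exists_schwartz_eq_bump φneg hε.ne' z
  refine ⟨𝓕⁻ ψ, fun y => ?_, fun x => ?_⟩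
  · rw [SchwartzMap.fourierInv_coe, Real.fourierInv_eq_fourier_neg, ← hψ, fourier_bump _ hε,
      neg_neg, smul_neg, h𝓕φneg, expFun_comm]
  · rw [← SchwartzMap.fourier_coe, FourierTransform.fourier_fourierInv_eq, ← hψ, bump, bump, hφneg,
      ← smul_neg, neg_sub]

theorem exists_schwartz_eq_norm_sq (f : 𝓢(Euc m, ℂ)) :
    ∃ g : 𝓢(Euc m, ℂ), ∀ x, g x = ((‖f x‖ ^ 2 : ℝ) : ℂ) :=
  ⟨SchwartzMap.pairing (ContinuousLinearMap.mul ℝ ℂ) f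
    (SchwartzMap.postcompCLM (𝕜 := ℝ) (Complex.conjCLE : ℂ →L[ℝ] ℂ) f), fun x => by
    simp [SchwartzMap.pairing_apply_apply, SchwartzMap.postcompCLM_apply, Complex.mul_conj']⟩

end Bumps

section Equidistribution

variable {n m : ℕ}

theorem summable_schwartz_mul (L : Submodule ℤ (Euc n × Euc m)) [DiscreteTopology L]
    [IsZLattice ℝ L] (K : 𝓢(Euc n, ℂ)) (w : 𝓢(Euc m, ℂ)) :
    Summable fun x : L => K (x : Euc n × Euc m).1 * w (x : Euc n × Euc m).2 :=
  ((decays_schwartz (n + m + 1) K).prod_mul (decays_schwartz _ w)).summable (by simp) L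

theorem summable_decayWeight_mul (L : Submodule ℤ (Euc n × Euc m)) [DiscreteTopology L]
    [IsZLattice ℝ L] {r : ℕ} (hr : n + m < r) :
    Summable fun x : L =>
      decayWeight r (x : Euc n × Euc m).1 * decayWeight r (x : Euc n × Euc m).2 :=
  (summable_decayWeight L (by simpa using hr)).of_nonneg_of_le
    (fun _ => mul_nonneg (decayWeight_nonneg _ _) (decayWeight_nonneg _ _))
    fun _ => decayWeight_fst_mul_decayWeight_snd_le r _

variable (Γ : Submodule ℤ (Euc n × Euc m)) [DiscreteTopology Γ] [IsZLattice ℝ Γ]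

theorem tsum_dualLattice_schwartz (K : 𝓢(Euc n, ℂ)) (w : 𝓢(Euc m, ℂ)) :
    ∑' y : dualLattice Γ, K (y : Euc n × Euc m).1 * w (y : Euc n × Euc m).2 =
      dualDensity Γ * ∑' x : Γ, 𝓕 (K : Euc n → ℂ) (x : Euc n × Euc m).1 *
        𝓕 (w : Euc m → ℂ) (x : Euc n × Euc m).2 := by
  have hdecays : ∀ {k} (f : 𝓢(Euc k, ℂ)), Decays (n + m + 1) (𝓕 (f : Euc k → ℂ)) := fun f => by
    rw [← SchwartzMap.fourier_coe]
    exact decays_schwartz _ (𝓕 f)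
  exact tsum_dualLattice_mul_eq_tsum_fourier_mul Γ (Nat.lt_succ_self _) (decays_schwartz _ K)
    (decays_schwartz _ w) (hdecays K) (hdecays w)

theorem summable_schwartz_mul_dilate (K : 𝓢(Euc n, ℂ)) (w : 𝓢(Euc m, ℂ)) {ε : ℝ} (hε : 0 < ε) :
    Summable fun y : dualLattice Γ => K (y : Euc n × Euc m).1 * w (ε • (y : Euc n × Euc m).2) := by
  obtain ⟨ψ, hψ⟩ := exists_schwartz_eq_bump w (inv_ne_zero hε.ne') 0
  refine (summable_mul_left_iff (a := ((√(ε ^ m) : ℝ) : ℂ))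
    (Complex.ofReal_ne_zero.2 (by positivity))).1 <|
      (summable_schwartz_mul (dualLattice Γ) K ψ).congr fun y => ?_
  rw [← hψ, bump_inv_zero, Complex.real_smul, mul_left_comm]

theorem pow_mul_tsum_dualLattice_schwartz (K : 𝓢(Euc n, ℂ)) (w : 𝓢(Euc m, ℂ)) {ε : ℝ}
    (hε : 0 < ε) :
    ((ε ^ m : ℝ) : ℂ) * ∑' y : dualLattice Γ,
        K (y : Euc n × Euc m).1 * w (ε • (y : Euc n × Euc m).2) =
      dualDensity Γ * ∑' x : Γ, 𝓕 (K : Euc n → ℂ) (x : Euc n × Euc m).1 *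
        𝓕 (w : Euc m → ℂ) (ε⁻¹ • (x : Euc n × Euc m).2) := by
  obtain ⟨ψ, hψ⟩ := exists_schwartz_eq_bump w (inv_ne_zero hε.ne') 0
  have hsq : ((ε ^ m : ℝ) : ℂ) = ((√(ε ^ m) : ℝ) : ℂ) * ((√(ε ^ m) : ℝ) : ℂ) := by
    rw [← Complex.ofReal_mul, Real.mul_self_sqrt (by positivity)]
  have hsqrt : ((√(ε ^ m) : ℝ) : ℂ) ≠ 0 := Complex.ofReal_ne_zero.2 (by positivity)
  have hpoisson := tsum_dualLattice_schwartz Γ K ψ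
  simp only [← hψ, bump_inv_zero, fourier_bump _ (inv_pos.2 hε), Complex.real_smul, inv_pow,
    Real.sqrt_inv, Complex.ofReal_inv, mul_left_comm _ (((√(ε ^ m) : ℝ) : ℂ)),
    mul_left_comm _ (((√(ε ^ m) : ℝ) : ℂ)⁻¹), tsum_mul_left] at hpoisson
  rw [hsq, mul_assoc, hpoisson, mul_inv_cancel_left₀ hsqrt]
  simp [expFun]

theorem tendsto_tsum_fourier_mul_dilate (hΓ : Set.InjOn Prod.snd (Γ : Set (Euc n × Euc m)))
    (K : 𝓢(Euc n, ℂ)) (w : 𝓢(Euc m, ℂ)) :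
    Tendsto (fun ε : ℝ => ∑' x : Γ, K (x : Euc n × Euc m).1 *
      w (ε⁻¹ • (x : Euc n × Euc m).2)) (𝓝[>] 0) (𝓝 (K 0 * w 0)) := by
  obtain ⟨C, hC, hle⟩ := (decays_schwartz (n + m + 1) K).exists_norm_mul_le
    (decays_schwartz (n + m + 1) w)
  rw [← tsum_ite_eq (0 : Γ) fun _ => K 0 * w 0]
  refine tendsto_tsum_of_dominated_convergence
    ((summable_decayWeight_mul Γ (Nat.lt_succ_self _)).mul_left C) (fun x => ?_) ?_
  · split_ifs with hx
    · simp [hx]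
    · have hx₂ : (x : Euc n × Euc m).2 ≠ 0 := fun h =>
        hx (Subtype.ext (hΓ x.2 (zero_mem Γ) (by simpa using h)))
      have hescape : Tendsto (fun ε : ℝ => ε⁻¹ • (x : Euc n × Euc m).2) (𝓝[>] 0)
          (Filter.cocompact _) := by
        rw [← Metric.cobounded_eq_cocompact, ← tendsto_norm_atTop_iff_cobounded]
        simp only [norm_smul]
        exact (tendsto_norm_atTop_atTop.comp tendsto_inv_nhdsGT_zero).atTop_mul_const
          (norm_pos_iff.2 hx₂)
      simpa using (w.tendsto_cocompact.comp hescape).const_mul (K (x : Euc n × Euc m).1)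
  · filter_upwards [Ioo_mem_nhdsGT (zero_lt_one (α := ℝ))] with ε hε x
    refine (hle _ _).trans ?_
    gcongr
    · exact decayWeight_nonneg _ _
    · refine decayWeight_anti ?_
      rw [norm_smul, norm_inv, Real.norm_of_nonneg hε.1.le]
      exact le_mul_of_one_le_left (norm_nonneg _) ((one_le_inv₀ hε.1).2 hε.2.le)

theorem tendsto_pow_mul_tsum_dualLattice
    (hΓ : Set.InjOn Prod.snd (Γ : Set (Euc n × Euc m))) (K : 𝓢(Euc n, ℂ)) (w : 𝓢(Euc m, ℂ)) :
    Tendsto (fun ε : ℝ => ((ε ^ m : ℝ) : ℂ) * ∑' y : dualLattice Γ,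
      K (y : Euc n × Euc m).1 * w (ε • (y : Euc n × Euc m).2)) (𝓝[>] 0)
      (𝓝 (dualDensity Γ * ((∫ x, K x) * ∫ y, w y))) := by
  have hzero : ∀ {k} (f : 𝓢(Euc k, ℂ)), 𝓕 f 0 = ∫ x, f x := fun f => by
    rw [SchwartzMap.fourier_coe, fourier_eq_integral_expFun_mul]
    simp [expFun]
  have hlim := (tendsto_tsum_fourier_mul_dilate Γ hΓ (𝓕 K) (𝓕 w)).const_mul (dualDensity Γ : ℂ)
  rw [hzero, hzero] at hlim
  refine hlim.congr' ?_
  filter_upwards [self_mem_nhdsWithin] with ε hε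
  rw [pow_mul_tsum_dualLattice_schwartz Γ K w hε, SchwartzMap.fourier_coe, SchwartzMap.fourier_coe]

theorem summable_norm_sq_dualLattice (K : 𝓢(Euc n, ℂ)) (w : 𝓢(Euc m, ℂ)) {ε : ℝ} (hε : 0 < ε) :
    Summable fun y : dualLattice Γ =>
      ‖K (y : Euc n × Euc m).1‖ ^ 2 * ‖w (ε • (y : Euc n × Euc m).2)‖ ^ 2 := by
  obtain ⟨K', hK'⟩ := exists_schwartz_eq_norm_sq K
  obtain ⟨w', hw'⟩ := exists_schwartz_eq_norm_sq w
  have h := summable_schwartz_mul_dilate Γ K' w' hε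
  simp only [hK', hw', ← Complex.ofReal_mul] at h
  exact Complex.summable_ofReal.1 h

theorem tendsto_pow_mul_tsum_norm_sq_dualLattice
    (hΓ : Set.InjOn Prod.snd (Γ : Set (Euc n × Euc m))) (K : 𝓢(Euc n, ℂ)) (w : 𝓢(Euc m, ℂ)) :
    Tendsto (fun ε : ℝ => ε ^ m * ∑' y : dualLattice Γ,
      ‖K (y : Euc n × Euc m).1‖ ^ 2 * ‖w (ε • (y : Euc n × Euc m).2)‖ ^ 2) (𝓝[>] 0)
      (𝓝 (dualDensity Γ * ((∫ x, ‖K x‖ ^ 2) * ∫ y, ‖w y‖ ^ 2))) := by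
  obtain ⟨K', hK'⟩ := exists_schwartz_eq_norm_sq K
  obtain ⟨w', hw'⟩ := exists_schwartz_eq_norm_sq w
  have h := tendsto_pow_mul_tsum_dualLattice Γ hΓ K' w'
  simp only [hK', hw', ← Complex.ofReal_mul, ← Complex.ofReal_tsum, integral_complex_ofReal] at h
  exact (Complex.continuous_re.tendsto _).comp h

end Equidistribution

section LTwo

variable {k : ℕ} {S : Set (Euc k)}

theorem memLp_of_continuous (hS : Bornology.IsBounded S) {f : Euc k → ℂ} (hf : Continuous f) :
    MemLp f 2 (volume.restrict S) := by
  have : IsFiniteMeasure (volume.restrict (closure S)) :=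
    ⟨by rw [Measure.restrict_apply_univ]; exact hS.closure.measure_lt_top⟩
  obtain ⟨C, hC⟩ := hS.isCompact_closure.exists_bound_of_continuousOn hf.continuousOn
  refine MemLp.mono_measure (Measure.restrict_mono subset_closure le_rfl)
    (MemLp.of_bound hf.aestronglyMeasurable C ?_)
  filter_upwards [ae_restrict_mem isClosed_closure.measurableSet] with x hx using hC x hx

/-- Restriction of continuous functions to a bounded set `S`, as vectors of `L²(S)`. -/
noncomputable def restrictLp (hS : Bornology.IsBounded S) :
    C(Euc k, ℂ) →ₗ[ℂ] Lp ℂ 2 (volume.restrict S) where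
  toFun f := (memLp_of_continuous hS f.continuous).toLp f
  map_add' _ _ := rfl
  map_smul' _ _ := rfl

theorem coeFn_restrictLp (hS : Bornology.IsBounded S) (f : C(Euc k, ℂ)) :
    restrictLp hS f =ᵐ[volume.restrict S] f :=
  (memLp_of_continuous hS f.continuous).coeFn_toLp

theorem inner_restrictLp (hS : Bornology.IsBounded S) (f g : C(Euc k, ℂ)) :
    (inner ℂ (restrictLp hS f) (restrictLp hS g) : ℂ) =
      ∫ x in S, (starRingEnd ℂ) (f x) * g x := by
  rw [L2.inner_def]
  refine integral_congr_ae ?_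
  filter_upwards [coeFn_restrictLp hS f, coeFn_restrictLp hS g] with x hf hg
  rw [hf, hg, RCLike.inner_apply, mul_comm]

theorem norm_sq_restrictLp (hS : Bornology.IsBounded S) (f : C(Euc k, ℂ)) :
    ‖restrictLp hS f‖ ^ 2 = ∫ x in S, ‖f x‖ ^ 2 := by
  have h := inner_restrictLp hS f f
  simp_rw [inner_self_eq_norm_sq_to_K, Complex.conj_mul', ← Complex.ofReal_pow,
    integral_complex_ofReal] at h
  exact Complex.ofReal_injective (by simpa using h)

theorem exists_norm_restrictLp_le (hS : Bornology.IsBounded S) :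
    ∃ M : ℝ, ∀ (f : C(Euc k, ℂ)) (C : ℝ), 0 ≤ C → (∀ x ∈ S, ‖f x‖ ≤ C) →
      ‖restrictLp hS f‖ ≤ M * C := by
  have : IsFiniteMeasure (volume.restrict S) :=
    ⟨by rw [Measure.restrict_apply_univ]; exact hS.measure_lt_top⟩
  refine ⟨_, fun f C hC hf => Lp.norm_le_of_ae_bound hC ?_⟩
  have hbound : ∀ᵐ x ∂volume.restrict S, ‖f x‖ ≤ C :=
    (ae_restrict_iff (isClosed_le (by fun_prop) continuous_const).measurableSet).2
      (ae_of_all _ hf)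
  filter_upwards [coeFn_restrictLp hS f, hbound] with x hx hle
  rwa [hx]

theorem tendsto_restrictLp (hS : Bornology.IsBounded S) {α : Type*} {l : Filter α}
    {g : α → C(Euc k, ℂ)} {F : C(Euc k, ℂ)} (hg : TendstoUniformlyOn (fun a x => g a x) F l S) :
    Tendsto (fun a => restrictLp hS (g a)) l (𝓝 (restrictLp hS F)) := by
  obtain ⟨M, hM⟩ := exists_norm_restrictLp_le hS
  refine Metric.tendsto_nhds.2 fun δ hδ => ?_
  have hM' : M < |M| + 1 := (le_abs_self M).trans_lt (lt_add_one _)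
  have hδ' : 0 < δ / (|M| + 1) := by positivity
  filter_upwards [Metric.tendstoUniformlyOn_iff.1 hg _ hδ'] with a ha
  rw [dist_eq_norm, ← map_sub]
  refine (hM _ _ hδ'.le fun x hx => ?_).trans_lt ?_
  · rw [ContinuousMap.sub_apply, ← dist_eq_norm, dist_comm]
    exact (ha x hx).le
  · exact (mul_lt_mul_of_pos_right hM' hδ').trans_eq (mul_div_cancel₀ δ (by positivity))

theorem hasSum_restrictLp (hS : Bornology.IsBounded S) {ι : Type*} {f : ι → C(Euc k, ℂ)}
    {F : C(Euc k, ℂ)} {u : ι → ℝ} (hu : Summable u) (hf : ∀ i, ∀ x ∈ S, ‖f i x‖ ≤ u i)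
    (hF : ∀ x ∈ S, ∑' i, f i x = F x) :
    HasSum (fun i => restrictLp hS (f i)) (restrictLp hS F) := by
  have hunif := (tendstoUniformlyOn_tsum hu hf).congr_right hF
  simp only [HasSum, SummationFilter.unconditional_filter, ← map_sum]
  exact tendsto_restrictLp hS (by simpa only [ContinuousMap.sum_apply] using hunif)

/-- The exponential with frequency `lam` as a continuous function. -/
noncomputable def expMap (lam : Euc k) : C(Euc k, ℂ) := ⟨expFun lam, continuous_expFun lam⟩

theorem star_expFun (lam x : Euc k) : (starRingEnd ℂ) (expFun lam x) = expFun (-lam) x := by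
  rw [expFun, expFun, ← Complex.exp_conj]
  simp only [map_mul, map_ofNat, Complex.conj_ofReal, Complex.conj_I, inner_neg_left,
    Complex.ofReal_neg, mul_neg, neg_mul]

theorem inner_restrictLp_expMap (hS : Bornology.IsBounded S) (lam : Euc k) {f : C(Euc k, ℂ)}
    (hf : ∀ x ∉ S, f x = 0) :
    (inner ℂ (restrictLp hS (expMap lam)) (restrictLp hS f) : ℂ) = 𝓕 (f : Euc k → ℂ) lam := by
  rw [inner_restrictLp, fourier_eq_integral_expFun_mul,
    setIntegral_eq_integral_of_forall_compl_eq_zero fun x hx => by rw [hf x hx, mul_zero]]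
  simp only [expMap, ContinuousMap.coe_mk, star_expFun]

end LTwo

section ApproachDirection

variable {m : ℕ} {V : Set (Euc m)} {u v : Euc m}

/-- `u` is a direction of approach to `v` which does not see the boundary of `V`: for small
`ε > 0`, the ball of centre `v + ε u` and radius `ε / 2` lies in `V` if `v ∈ V`, and outside of
`V` otherwise. -/
def IsApproachDirection (V : Set (Euc m)) (u v : Euc m) : Prop :=
  ∀ᶠ ε : ℝ in 𝓝[>] 0, ∀ w ∈ Metric.ball u (1 / 2), v + ε • w ∈ V ↔ v ∈ V

theorem IsApproachDirection.neg (h : IsApproachDirection V u v) :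
    IsApproachDirection (-V) (-u) (-v) := by
  filter_upwards [h] with ε hε w hw
  rw [Set.mem_neg, Set.mem_neg, neg_add, neg_neg, ← smul_neg]
  exact hε (-w) (by rwa [mem_ball_iff_norm, ← norm_neg, neg_sub', neg_neg, ← mem_ball_iff_norm])

theorem isApproachDirection_zero_of_notMem_frontier (hv : v ∉ frontier V) :
    IsApproachDirection V 0 v := by
  have hlocal : ∀ᶠ y in 𝓝 v, (y ∈ V ↔ v ∈ V) := by
    by_cases hvV : v ∈ V
    · have hV : V ∈ 𝓝 v := mem_interior_iff_mem_nhds.1 <| by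
        by_contra hint
        exact hv ⟨subset_closure hvV, hint⟩
      filter_upwards [hV] with y hy using iff_of_true hy hvV
    · have hV : Vᶜ ∈ 𝓝 v := mem_interior_iff_mem_nhds.1 <| by
        rw [interior_compl]
        exact fun hcl => hv ⟨hcl, fun hint => hvV (interior_subset hint)⟩
      filter_upwards [hV] with y hy using iff_of_false hy hvV
  obtain ⟨δ, hδ, hball⟩ := Metric.eventually_nhds_iff_ball.1 hlocal
  filter_upwards [Ioo_mem_nhdsGT hδ] with ε hε w hw
  refine hball _ ?_
  rw [mem_ball_zero_iff] at hw
  rw [mem_ball_iff_norm, add_sub_cancel_left, norm_smul, Real.norm_of_nonneg hε.1.le]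
  nlinarith [hε.1, hε.2, norm_nonneg w]

theorem isApproachDirection_of_eventually_nhdsGT {I : Set ℝ} {v : Euc 1}
    (h : ∀ᶠ t in 𝓝[>] v 0, (t ∈ I ↔ v 0 ∈ I)) :
    IsApproachDirection {y : Euc 1 | y 0 ∈ I} (WithLp.toLp 2 fun _ => 1 / 2) v := by
  obtain ⟨b, hb, hI⟩ := mem_nhdsGT_iff_exists_Ioo_subset.1 h
  filter_upwards [Ioo_mem_nhdsGT (sub_pos.2 (Set.mem_Ioi.1 hb))] with ε hε w hw
  have hw0 := abs_lt.1 ((PiLp.norm_apply_le (w - WithLp.toLp 2 fun _ => 1 / 2) 0).trans_lt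
    (mem_ball_iff_norm.1 hw))
  simp only [PiLp.sub_apply] at hw0
  refine hI (a := v 0 + ε * w 0) ⟨?_, ?_⟩ <;> nlinarith [hε.1, hε.2]

theorem eventually_mem_Ico_iff (a b t : ℝ) :
    ∀ᶠ s in 𝓝[>] t, (s ∈ Set.Ico a b ↔ t ∈ Set.Ico a b) := by
  rcases lt_or_ge t a with hta | hat
  · filter_upwards [Ioo_mem_nhdsGT hta] with s hs
    grind
  rcases lt_or_ge t b with htb | hbt
  · filter_upwards [Ioo_mem_nhdsGT htb] with s hs
    grind
  · filter_upwards [self_mem_nhdsWithin] with s hs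
    grind

theorem IsSemiClosedInterval.exists_isApproachDirection (h : IsSemiClosedInterval V) :
    ∃ u, ∀ v, IsApproachDirection V u v := by
  obtain ⟨rfl, a, b, -, rfl | rfl⟩ := h <;> simp only [Fin.forall_fin_one]
  · exact ⟨_, fun v => isApproachDirection_of_eventually_nhdsGT (eventually_mem_Ico_iff a b _)⟩
  · have hneg : {y : Euc 1 | y 0 ∈ Set.Ioc a b} = -{y : Euc 1 | y 0 ∈ Set.Ico (-b) (-a)} := by
      ext y
      simp [and_comm]
    refine ⟨-WithLp.toLp 2 fun _ => 1 / 2, fun v => ?_⟩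
    rw [hneg, ← neg_neg v]
    exact (isApproachDirection_of_eventually_nhdsGT (eventually_mem_Ico_iff (-b) (-a) _)).neg

end ApproachDirection

section BumpSystems

variable {m : ℕ} {V : Set (Euc m)} {u v : Euc m} {φ : 𝓢(Euc m, ℂ)} {ε : ℝ}

/-- Admissible bump profiles: Schwartz functions of `L²` norm one which vanish off the ball of
radius `1 / 2` around `u`. -/
structure IsUnitBump (φ : 𝓢(Euc m, ℂ)) (u : Euc m) : Prop where
  eq_zero : ∀ y ∉ Metric.ball u (1 / 2), φ y = 0
  integral_norm_sq : ∫ y, ‖φ y‖ ^ 2 = 1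

theorem exists_isUnitBump (u : Euc m) : ∃ φ : 𝓢(Euc m, ℂ), IsUnitBump φ u := by
  obtain ⟨b, hb, hcs, hsm, -, hbu⟩ := exists_contDiff_tsupport_subset (n := ⊤)
    (Metric.ball_mem_nhds u (one_half_pos (α := ℝ)))
  have hs : HasCompactSupport fun y => (b y : ℂ) := hcs.comp_left (g := Complex.ofReal) rfl
  set ψ : 𝓢(Euc m, ℂ) := hs.toSchwartzMap (Complex.ofRealCLM.contDiff.comp hsm)
  have hψ (y : Euc m) : ψ y = b y := rfl
  have hpos : 0 < ∫ y, ‖ψ y‖ ^ 2 :=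
    (ψ.continuous.norm.pow 2).integral_pos_of_hasCompactSupport_nonneg_nonzero (x := u)
      (hs.comp_left (g := fun z : ℂ => ‖z‖ ^ 2) (by simp)) (fun y => by positivity)
      (by simp [hψ, hbu])
  refine ⟨(√(∫ y, ‖ψ y‖ ^ 2))⁻¹ • ψ, fun y hy => ?_, ?_⟩
  · rw [smul_apply, hψ, image_eq_zero_of_notMem_tsupport fun h => hy (hb h),
      Complex.ofReal_zero, smul_zero]
  · simp only [smul_apply, norm_smul, mul_pow]
    rw [integral_const_mul, norm_inv, inv_pow, Real.norm_of_nonneg (Real.sqrt_nonneg _),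
      Real.sq_sqrt hpos.le, inv_mul_cancel₀ hpos.ne']

/-- The bump of profile `φ`, size `ε` and centre `v` as a vector of `L²(V)`. -/
noncomputable def bumpLp (hV : Bornology.IsBounded V) (φ : 𝓢(Euc m, ℂ)) (ε : ℝ) (v : Euc m) :
    Lp ℂ 2 (volume.restrict V) :=
  restrictLp hV ⟨bump φ ε v, continuous_bump φ.continuous ε v⟩

theorem norm_sq_bumpLp (hV : Bornology.IsBounded V) (φ : 𝓢(Euc m, ℂ)) (ε : ℝ) (v : Euc m) :
    ‖bumpLp hV φ ε v‖ ^ 2 = ∫ y in V, ‖bump φ ε v y‖ ^ 2 :=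
  norm_sq_restrictLp hV _

namespace IsUnitBump

theorem exists_mem_ball_of_bump_ne_zero (hφ : IsUnitBump φ u) (hε : 0 < ε) {y : Euc m}
    (hy : bump φ ε v y ≠ 0) : ∃ w ∈ Metric.ball u (1 / 2), v + ε • w = y := by
  refine ⟨ε⁻¹ • (y - v), by_contra fun h => hy ?_, ?_⟩
  · rw [bump, hφ.eq_zero _ h, smul_zero]
  · rw [smul_inv_smul₀ hε.ne', add_sub_cancel]

theorem eventually_bump_eq_zero (hφ : IsUnitBump φ u) (hv : IsApproachDirection V u v) :
    ∀ᶠ ε : ℝ in 𝓝[>] 0, ∀ y, ¬(y ∈ V ↔ v ∈ V) → bump φ ε v y = 0 := by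
  filter_upwards [hv, self_mem_nhdsWithin] with ε hmem hε y hy
  by_contra hne
  obtain ⟨w, hw, rfl⟩ := hφ.exists_mem_ball_of_bump_ne_zero hε hne
  exact hy (hmem w hw)

theorem tendsto_norm_sq_bumpLp (hφ : IsUnitBump φ u) (hV : Bornology.IsBounded V)
    (hv : IsApproachDirection V u v) :
    Tendsto (fun ε => ‖bumpLp hV φ ε v‖ ^ 2) (𝓝[>] 0) (𝓝 (V.indicator 1 v)) := by
  refine tendsto_const_nhds.congr' ?_
  filter_upwards [hφ.eventually_bump_eq_zero hv, self_mem_nhdsWithin] with ε hzero hε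
  rw [norm_sq_bumpLp]
  by_cases hvV : v ∈ V
  · rw [setIntegral_eq_integral_of_forall_compl_eq_zero fun y hy => by
      rw [hzero y fun h => hy (h.2 hvV), norm_zero, zero_pow two_ne_zero],
      integral_norm_sq_bump _ hε, hφ.integral_norm_sq, Set.indicator_of_mem hvV, Pi.one_apply]
  · rw [setIntegral_eq_zero_of_forall_eq_zero fun y hy => by
      rw [hzero y fun h => hvV (h.1 hy), norm_zero, zero_pow two_ne_zero],
      Set.indicator_of_notMem hvV]

theorem tendsto_inner_bumpLp (hφ : IsUnitBump φ u) (hV : Bornology.IsBounded V) {v' : Euc m}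
    (hne : v ≠ v') :
    Tendsto (fun ε => (inner ℂ (bumpLp hV φ ε v) (bumpLp hV φ ε v') : ℂ)) (𝓝[>] 0) (𝓝 0) := by
  refine tendsto_const_nhds.congr' ?_
  filter_upwards [Ioo_mem_nhdsGT (dist_pos.2 hne)] with ε hε
  rw [bumpLp, bumpLp, inner_restrictLp, eq_comm]
  refine setIntegral_eq_zero_of_forall_eq_zero fun y _ => by_contra fun hy => ?_
  obtain ⟨hy₁, hy₂⟩ := mul_ne_zero_iff.1 hy
  obtain ⟨w, hw, hwy⟩ := hφ.exists_mem_ball_of_bump_ne_zero hε.1 ((map_ne_zero _).1 hy₁)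
  obtain ⟨w', hw', rfl⟩ := hφ.exists_mem_ball_of_bump_ne_zero hε.1 hy₂
  have hsub : v - v' = ε • (w' - w) := by
    rw [smul_sub, sub_eq_sub_iff_add_eq_add, hwy, add_comm]
  have hdist : dist w' w < 1 := by
    linarith [dist_triangle_right w' w u, Metric.mem_ball.1 hw, Metric.mem_ball.1 hw']
  have hlt := hε.2
  rw [dist_eq_norm, hsub, norm_smul, Real.norm_of_nonneg hε.1.le, ← dist_eq_norm] at hlt
  nlinarith [hε.1]

theorem norm_bumpLp_le_one (hφ : IsUnitBump φ u) (hV : Bornology.IsBounded V) (hε : 0 < ε) :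
    ‖bumpLp hV φ ε v‖ ≤ 1 := by
  obtain ⟨ψ, hψ⟩ := exists_schwartz_eq_bump φ hε.ne' v
  have hint : Integrable fun y => ‖bump φ ε v y‖ ^ 2 := by
    rw [hψ]
    exact (memLp_two_iff_integrable_sq_norm ψ.continuous.aestronglyMeasurable).1 (ψ.memLp 2)
  rw [← sq_le_one_iff₀ (norm_nonneg _), norm_sq_bumpLp, ← hφ.integral_norm_sq,
    ← integral_norm_sq_bump _ hε v]
  exact setIntegral_le_integral hint (ae_of_all _ fun y => by positivity)

theorem exists_norm_bumpLp_le (hφ : IsUnitBump φ u) (hV : Bornology.IsBounded V) (r : ℕ) :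
    ∃ K : ℝ, ∀ ε ∈ Set.Ioo (0 : ℝ) 1, ∀ v, ‖bumpLp hV φ ε v‖ ≤ K * decayWeight r v := by
  obtain ⟨R, hR0, hR⟩ := hV.exists_pos_norm_le
  refine ⟨(1 + (R + (‖u‖ + 1))) ^ r, fun ε hε v => ?_⟩
  by_cases hzero : ∀ y ∈ V, bump φ ε v y = 0
  · have hnorm : ‖bumpLp hV φ ε v‖ ^ 2 = 0 := by
      rw [norm_sq_bumpLp]
      exact setIntegral_eq_zero_of_forall_eq_zero fun y hy => by simp [hzero y hy]
    rw [pow_eq_zero_iff two_ne_zero] at hnorm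
    rw [hnorm]
    exact mul_nonneg (by positivity) (decayWeight_nonneg _ _)
  push Not at hzero
  obtain ⟨y, hyV, hy⟩ := hzero
  obtain ⟨w, hw, rfl⟩ := hφ.exists_mem_ball_of_bump_ne_zero hε.1 hy
  have hwnorm : ‖w‖ ≤ ‖u‖ + 1 := by
    linarith [norm_le_norm_add_norm_sub' w u, mem_ball_iff_norm.1 hw]
  have hvnorm : ‖v‖ ≤ R + (‖u‖ + 1) := calc
    ‖v‖ = ‖v + ε • w - ε • w‖ := by rw [add_sub_cancel_right]
    _ ≤ ‖v + ε • w‖ + ε * ‖w‖ := by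
      simpa only [norm_smul, Real.norm_of_nonneg hε.1.le] using norm_sub_le (v + ε • w) (ε • w)
    _ ≤ R + (‖u‖ + 1) :=
      add_le_add (hR _ hyV) ((mul_le_of_le_one_left (norm_nonneg w) hε.2.le).trans hwnorm)
  exact (hφ.norm_bumpLp_le_one hV hε.1).trans (one_le_mul_decayWeight hvnorm)

theorem tendsto_norm_sq_tsum_smul_bumpLp (hφ : IsUnitBump φ u) (hV : Bornology.IsBounded V)
    {ι : Type*} {v : ι → Euc m} (hinj : Function.Injective v)
    (hv : ∀ i, IsApproachDirection V u (v i)) {a : ι → ℂ} {r : ℕ}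
    (ha : Summable fun i => ‖a i‖ * decayWeight r (v i)) :
    Tendsto (fun ε => ‖∑' i, a i • bumpLp hV φ ε (v i)‖ ^ 2) (𝓝[>] 0)
      (𝓝 (∑' i, {i | v i ∈ V}.indicator (fun i => ‖a i‖ ^ 2) i)) := by
  obtain ⟨K, hK⟩ := hφ.exists_norm_bumpLp_le hV r
  refine tendsto_norm_sq_tsum_of_tendsto_inner_zero (ha.mul_left K) ?_ (fun i j hij => ?_)
    fun i => ?_
  · filter_upwards [Ioo_mem_nhdsGT one_pos] with ε hε i
    rw [norm_smul, mul_left_comm]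
    exact mul_le_mul_of_nonneg_left (hK ε hε (v i)) (norm_nonneg _)
  · simp only [inner_smul_left, inner_smul_right]
    simpa only [mul_zero] using
      ((hφ.tendsto_inner_bumpLp hV (hinj.ne hij)).const_mul ((starRingEnd ℂ) (a i))).const_mul
        (a j)
  · have hlim := (hφ.tendsto_norm_sq_bumpLp hV (hv i)).const_mul (‖a i‖ ^ 2)
    simp only [norm_smul, mul_pow]
    convert hlim using 2
    by_cases hi : v i ∈ V <;> simp [Set.indicator, hi]

end IsUnitBump

end BumpSystems

/-! ### Smooth cutoffs -/

section Cutoffs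

variable {n : ℕ} {U W : Set (Euc n)} {θ : ℕ → Euc n → ℝ}

/-- `θ` is a sequence of smooth cutoffs for `W`: functions with values in `[0, 1]` and supports in
a common compact set, which converge pointwise to the indicator function of `W`. -/
structure IsCutoffSequence (W : Set (Euc n)) (θ : ℕ → Euc n → ℝ) : Prop where
  contDiff : ∀ j, ContDiff ℝ ∞ (θ j)
  mem_Icc : ∀ j x, θ j x ∈ Set.Icc 0 1
  exists_isCompact : ∃ K, IsCompact K ∧ ∀ j, ∀ x ∉ K, θ j x = 0
  tendsto : ∀ x, Tendsto (fun j => θ j x) atTop (𝓝 (W.indicator 1 x))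

theorem tendsto_one_sub_pow_indicator {g : Euc n → ℝ} (hg : Set.range g ⊆ Set.Icc 0 1)
    (x : Euc n) :
    Tendsto (fun j : ℕ => (1 - g x) ^ j) atTop (𝓝 ((Function.support g)ᶜ.indicator 1 x)) := by
  have h01 := hg ⟨x, rfl⟩
  by_cases hx : g x = 0
  · simp [hx]
  · rw [Set.indicator_of_notMem (by simpa using hx)]
    have hpos : 0 < g x := h01.1.lt_of_ne' hx
    exact tendsto_pow_atTop_nhds_zero_of_lt_one (by linarith [h01.2]) (by linarith)

theorem one_sub_pow_mem_Icc {g : Euc n → ℝ} (hg : Set.range g ⊆ Set.Icc 0 1) (j : ℕ) (x : Euc n) :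
    (1 - g x) ^ j ∈ Set.Icc 0 1 := by
  obtain ⟨h0, h1⟩ := hg ⟨x, rfl⟩
  exact ⟨pow_nonneg (by linarith) _, pow_le_one₀ (by linarith) (by linarith)⟩

theorem exists_isCutoffSequence_of_isCompact (hW : IsCompact W) :
    ∃ θ, IsCutoffSequence W θ ∧ ∀ j, ∀ x ∈ W, θ j x = 1 := by
  obtain ⟨R, hR0, hR⟩ := hW.isBounded.subset_closedBall_lt 0 0
  let b : ContDiffBump (0 : Euc n) := ⟨R, R + 1, hR0, by linarith⟩
  have hb (x : Euc n) (hx : x ∈ W) : b x = 1 := b.one_of_mem_closedBall (hR hx)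
  obtain ⟨g, hgsupp, hg, hg01⟩ := hW.isClosed.isOpen_compl.exists_contDiff_support_eq (n := ⊤)
  have hlim := tendsto_one_sub_pow_indicator hg01
  rw [hgsupp, compl_compl] at hlim
  refine ⟨fun j x => b x * (1 - g x) ^ j, ⟨fun j => b.contDiff.mul ((contDiff_const.sub hg).pow j),
    fun j x => ?_, ⟨_, b.hasCompactSupport, fun j x hx => ?_⟩, fun x => ?_⟩, fun j x hx => ?_⟩
  · obtain ⟨h0, h1⟩ := one_sub_pow_mem_Icc hg01 j x
    exact ⟨mul_nonneg b.nonneg h0, mul_le_one₀ b.le_one h0 h1⟩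
  · rw [image_eq_zero_of_notMem_tsupport hx, zero_mul]
  · convert (hlim x).const_mul (b x) using 2
    by_cases hx : x ∈ W <;> simp [hx, hb]
  · have hgx : g x = 0 := Function.notMem_support.1 (by rwa [hgsupp, Set.notMem_compl_iff])
    simp only [hb x hx, hgx, sub_zero, one_pow, one_mul]

theorem exists_isCutoffSequence_of_isOpen (hW : IsOpen W) (hbdd : Bornology.IsBounded W) :
    ∃ θ, IsCutoffSequence W θ ∧ ∀ j, ∀ x ∉ W, θ j x = 0 := by
  obtain ⟨g, hgsupp, hg, hg01⟩ := hW.exists_contDiff_support_eq (n := ⊤)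
  have hlim := tendsto_one_sub_pow_indicator hg01
  rw [hgsupp] at hlim
  have hzero (j : ℕ) (x : Euc n) (hx : x ∉ W) : 1 - (1 - g x) ^ j = 0 := by
    have hgx : g x = 0 := Function.notMem_support.1 (by rwa [hgsupp])
    rw [hgx, sub_zero, one_pow, sub_self]
  refine ⟨fun j x => 1 - (1 - g x) ^ j,
    ⟨fun j => contDiff_const.sub ((contDiff_const.sub hg).pow j), fun j x => ?_,
      ⟨_, hbdd.isCompact_closure, fun j x hx => hzero j x fun h => hx (subset_closure h)⟩,
      fun x => ?_⟩, hzero⟩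
  · obtain ⟨h0, h1⟩ := one_sub_pow_mem_Icc hg01 j x
    exact ⟨sub_nonneg.2 h1, sub_le_self _ h0⟩
  · convert (hlim x).const_sub 1 using 2
    by_cases hx : x ∈ W <;> simp [hx]

namespace IsCutoffSequence

theorem exists_schwartz_eq_smul (hθ : IsCutoffSequence W θ) {f : Euc n → ℂ} (hf : ContDiff ℝ ∞ f)
    (j : ℕ) : ∃ η : 𝓢(Euc n, ℂ), ∀ x, η x = θ j x • f x := by
  obtain ⟨K, hK, hzero⟩ := hθ.exists_isCompact
  have hsupp : HasCompactSupport (θ j) := HasCompactSupport.intro hK (hzero j)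
  exact ⟨hsupp.smul_right.toSchwartzMap ((hθ.contDiff j).smul hf), fun x => rfl⟩

theorem tendsto_integral_norm_sq (hθ : IsCutoffSequence W θ) (hW : MeasurableSet W)
    {f : Euc n → ℂ} (hf : Continuous f) :
    Tendsto (fun j => ∫ x, ‖θ j x • f x‖ ^ 2) atTop (𝓝 (∫ x in W, ‖f x‖ ^ 2)) := by
  obtain ⟨K, hK, hzero⟩ := hθ.exists_isCompact
  rw [← integral_indicator hW]
  have hcont (j : ℕ) : Continuous (θ j) := (hθ.contDiff j).continuous
  refine tendsto_integral_of_dominated_convergence (K.indicator fun x => ‖f x‖ ^ 2)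
    (fun j => by have := hcont j; fun_prop) ?_ (fun j => ae_of_all _ fun x => ?_)
    (ae_of_all _ fun x => ?_)
  · exact ((hf.norm.pow 2).continuousOn.integrableOn_compact hK).integrable_indicator
      hK.measurableSet
  · by_cases hx : x ∈ K
    · rw [Set.indicator_of_mem hx, Real.norm_of_nonneg (by positivity), norm_smul,
        Real.norm_of_nonneg (hθ.mem_Icc j x).1]
      have hle := mul_le_of_le_one_left (norm_nonneg (f x)) (hθ.mem_Icc j x).2
      have hnonneg := (hθ.mem_Icc j x).1
      gcongr
    · simp [hzero j x hx, hx]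
  · have hlim : Tendsto (fun j => θ j x • f x) atTop (𝓝 (W.indicator (1 : Euc n → ℝ) x • f x)) :=
      (hθ.tendsto x).smul_const (f x)
    convert hlim.norm.pow 2 using 2
    by_cases hx : x ∈ W <;> simp [hx]

end IsCutoffSequence

theorem RiemannMeasurable.exists_schwartz_eqOn (hU : RiemannMeasurable U) {f : Euc n → ℂ}
    (hf : ContDiff ℝ ∞ f) :
    ∃ η : ℕ → 𝓢(Euc n, ℂ), (∀ j, Set.EqOn (η j) f U) ∧
      Tendsto (fun j => ∫ x, ‖η j x‖ ^ 2) atTop (𝓝 (∫ x in U, ‖f x‖ ^ 2)) := by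
  obtain ⟨θ, hθ, hone⟩ := exists_isCutoffSequence_of_isCompact hU.bounded.isCompact_closure
  choose η hη using hθ.exists_schwartz_eq_smul hf
  refine ⟨η, fun j x hx => by rw [hη, hone j x (subset_closure hx), one_smul], ?_⟩
  simp only [hη]
  rw [← setIntegral_congr_set (closure_ae_eq_of_null_frontier hU.null_frontier)]
  exact hθ.tendsto_integral_norm_sq isClosed_closure.measurableSet hf.continuous

theorem norm_sq_sub_smul_le {t : ℝ} (ht : t ∈ Set.Icc (0 : ℝ) 1) (z : ℂ) :
    ‖z - t • z‖ ^ 2 ≤ ‖z‖ ^ 2 - ‖t • z‖ ^ 2 := by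
  have hsub : z - t • z = (1 - t) • z := by rw [sub_smul, one_smul]
  rw [hsub, norm_smul, norm_smul, Real.norm_of_nonneg ht.1, Real.norm_of_nonneg (sub_nonneg.2 ht.2)]
  nlinarith [mul_nonneg (mul_nonneg ht.1 (sub_nonneg.2 ht.2)) (sq_nonneg ‖z‖)]

theorem RiemannMeasurable.exists_schwartz_eq_zero (hU : RiemannMeasurable U) {f : Euc n → ℂ}
    (hf : ContDiff ℝ ∞ f) :
    ∃ η : ℕ → 𝓢(Euc n, ℂ), (∀ j, ∀ x ∉ U, η j x = 0) ∧
      (∀ j x, ‖f x - η j x‖ ^ 2 ≤ ‖f x‖ ^ 2 - ‖η j x‖ ^ 2) ∧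
      Tendsto (fun j => ∫ x, ‖η j x‖ ^ 2) atTop (𝓝 (∫ x in U, ‖f x‖ ^ 2)) := by
  obtain ⟨θ, hθ, hzero⟩ :=
    exists_isCutoffSequence_of_isOpen isOpen_interior (hU.bounded.subset interior_subset)
  choose η hη using hθ.exists_schwartz_eq_smul hf
  refine ⟨η, fun j x hx => ?_, fun j x => ?_, ?_⟩
  · rw [hη, hzero j x fun h => hx (interior_subset h), zero_smul]
  · rw [hη]
    exact norm_sq_sub_smul_le (hθ.mem_Icc j x) (f x)
  simp only [hη]
  rw [← setIntegral_congr_set (interior_ae_eq_of_null_frontier hU.null_frontier)]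
  exact hθ.tendsto_integral_norm_sq isOpen_interior.measurableSet hf.continuous

theorem RiemannMeasurable.dense_restrictLp_schwartz (hU : RiemannMeasurable U) :
    Dense {F | ∃ ψ : 𝓢(Euc n, ℂ), (∀ x ∉ U, ψ x = 0) ∧
      restrictLp hU.bounded ⟨ψ, ψ.continuous⟩ = F} := by
  have : IsFiniteMeasure (volume.restrict U) :=
    ⟨by rw [Measure.restrict_apply_univ]; exact hU.bounded.measure_lt_top⟩
  refine dense_closure.1 ((denseRange_toLpCLM (p := 2) (by norm_num)).mono ?_)
  rintro _ ⟨ψ, rfl⟩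
  obtain ⟨η, hηzero, hηle, hηlim⟩ := hU.exists_schwartz_eq_zero (ψ.smooth ⊤)
  have hintegrable (f : 𝓢(Euc n, ℂ)) : IntegrableOn (fun x => ‖f x‖ ^ 2) U :=
    ((memLp_two_iff_integrable_sq_norm f.continuous.aestronglyMeasurable).1
      (f.memLp 2)).integrableOn
  have hηint (j : ℕ) : ∫ x in U, ‖η j x‖ ^ 2 = ∫ x, ‖η j x‖ ^ 2 :=
    setIntegral_eq_integral_of_forall_compl_eq_zero fun x hx => by
      rw [hηzero j x hx, norm_zero, zero_pow two_ne_zero]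
  have hdist (j : ℕ) : ‖restrictLp hU.bounded ⟨η j, (η j).continuous⟩ -
      restrictLp hU.bounded ⟨ψ, ψ.continuous⟩‖ ^ 2 ≤
      (∫ x in U, ‖ψ x‖ ^ 2) - ∫ x, ‖η j x‖ ^ 2 := by
    rw [norm_sub_rev, ← map_sub, norm_sq_restrictLp, ← hηint,
      ← integral_sub (hintegrable ψ) (hintegrable (η j))]
    exact integral_mono (hintegrable (ψ - η j)) ((hintegrable ψ).sub (hintegrable (η j))) (hηle j)
  have hgap := hηlim.const_sub (∫ x in U, ‖ψ x‖ ^ 2)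
  rw [sub_self] at hgap
  have hsq := squeeze_zero (fun j => by positivity) hdist hgap
  have hlim : Tendsto (fun j => restrictLp hU.bounded ⟨η j, (η j).continuous⟩) atTop
      (𝓝 (restrictLp hU.bounded ⟨ψ, ψ.continuous⟩)) :=
    tendsto_iff_norm_sub_tendsto_zero.2 (by simpa [Real.sqrt_sq] using hsq.sqrt)
  exact mem_closure_of_tendsto hlim (Eventually.of_forall fun j => ⟨η j, hηzero j, rfl⟩)

end Cutoffs

section Strips

variable {n m : ℕ}

/-- The points of a lattice in `ℝⁿ × ℝᵐ` lying above `U ⊆ ℝⁿ`. -/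
def fstStrip (L : Submodule ℤ (Euc n × Euc m)) (U : Set (Euc n)) : Set L := {x | x.1.1 ∈ U}

/-- The points of a lattice in `ℝⁿ × ℝᵐ` lying above `V ⊆ ℝᵐ`. -/
def sndStrip (L : Submodule ℤ (Euc n × Euc m)) (V : Set (Euc m)) : Set L := {x | x.1.2 ∈ V}

theorem tendsto_of_tendsto_of_forall_le {α : Type*} {l : Filter α} {F : α → ℝ} {x : ℝ}
    {L R : ℕ → α → ℝ} {a b : ℕ → ℝ} (hL : ∀ j, Tendsto (L j) l (𝓝 (a j)))
    (hR : ∀ j, Tendsto (R j) l (𝓝 (b j))) (ha : Tendsto a atTop (𝓝 x))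
    (hb : Tendsto b atTop (𝓝 x)) (hLF : ∀ j, ∀ᶠ t in l, L j t ≤ F t)
    (hFR : ∀ j, ∀ᶠ t in l, F t ≤ R j t) : Tendsto F l (𝓝 x) := by
  refine tendsto_order.2 ⟨fun y hy => ?_, fun y hy => ?_⟩
  · obtain ⟨j, hj⟩ := (ha.eventually_const_lt hy).exists
    filter_upwards [(hL j).eventually_const_lt hj, hLF j] with t ht hle using ht.trans_le hle
  · obtain ⟨j, hj⟩ := (hb.eventually_lt_const hy).exists
    filter_upwards [(hR j).eventually_lt_const hj, hFR j] with t ht hle using hle.trans_lt ht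

variable (Γ : Submodule ℤ (Euc n × Euc m)) [DiscreteTopology Γ] [IsZLattice ℝ Γ] {U : Set (Euc n)}

theorem summable_norm_sq_fstStrip (hU : RiemannMeasurable U) {f : Euc n → ℂ}
    (hf : ContDiff ℝ ∞ f) (w : 𝓢(Euc m, ℂ)) {ε : ℝ} (hε : 0 < ε) :
    Summable fun y : fstStrip (dualLattice Γ) U => ‖f y.1.1.1‖ ^ 2 * ‖w (ε • y.1.1.2)‖ ^ 2 := by
  obtain ⟨η, hη, -⟩ := hU.exists_schwartz_eqOn hf
  refine ((summable_norm_sq_dualLattice Γ (η 0) w hε).subtype _).congr fun y => ?_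
  rw [Function.comp_apply, hη 0 y.2]

theorem tendsto_pow_mul_tsum_norm_sq_fstStrip (hΓ : Set.InjOn Prod.snd (Γ : Set (Euc n × Euc m)))
    (hU : RiemannMeasurable U) {f : Euc n → ℂ} (hf : ContDiff ℝ ∞ f) (w : 𝓢(Euc m, ℂ)) :
    Tendsto (fun ε : ℝ => ε ^ m * ∑' y : fstStrip (dualLattice Γ) U,
      ‖f y.1.1.1‖ ^ 2 * ‖w (ε • y.1.1.2)‖ ^ 2) (𝓝[>] 0)
      (𝓝 (dualDensity Γ * ((∫ x in U, ‖f x‖ ^ 2) * ∫ y, ‖w y‖ ^ 2))) := by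
  obtain ⟨outer, houter, houterlim⟩ := hU.exists_schwartz_eqOn hf
  obtain ⟨inner, hinner, hinnerle, hinnerlim⟩ := hU.exists_schwartz_eq_zero hf
  refine tendsto_of_tendsto_of_forall_le
    (fun j => tendsto_pow_mul_tsum_norm_sq_dualLattice Γ hΓ (inner j) w)
    (fun j => tendsto_pow_mul_tsum_norm_sq_dualLattice Γ hΓ (outer j) w)
    ((hinnerlim.mul_const _).const_mul _) ((houterlim.mul_const _).const_mul _)
    (fun j => ?_) fun j => ?_
  · filter_upwards [self_mem_nhdsWithin] with ε hε
    refine mul_le_mul_of_nonneg_left ?_ (pow_nonneg (le_of_lt hε) m)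
    have hsupp : (Function.support fun y : dualLattice Γ =>
        ‖inner j y.1.1‖ ^ 2 * ‖w (ε • y.1.2)‖ ^ 2) ⊆ fstStrip (dualLattice Γ) U := fun y hy =>
      by_contra fun hyU => hy (by simp [hinner j y.1.1 hyU])
    rw [← tsum_subtype_eq_of_support_subset hsupp]
    refine ((summable_norm_sq_dualLattice Γ (inner j) w hε).subtype _).tsum_le_tsum (fun y => ?_)
      (summable_norm_sq_fstStrip Γ hU hf w hε)
    have hle : ‖inner j y.1.1.1‖ ^ 2 ≤ ‖f y.1.1.1‖ ^ 2 :=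
      sub_nonneg.1 ((sq_nonneg _).trans (hinnerle j y.1.1.1))
    gcongr
  · filter_upwards [self_mem_nhdsWithin] with ε hε
    refine mul_le_mul_of_nonneg_left ?_ (pow_nonneg (le_of_lt hε) m)
    have hrestrict (y : fstStrip (dualLattice Γ) U) :
        ‖f y.1.1.1‖ ^ 2 * ‖w (ε • y.1.1.2)‖ ^ 2 =
          ‖outer j y.1.1.1‖ ^ 2 * ‖w (ε • y.1.1.2)‖ ^ 2 := by rw [houter j y.2]
    rw [tsum_congr hrestrict]
    exact (summable_norm_sq_dualLattice Γ (outer j) w hε).tsum_subtype_le _ _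
      fun y => by positivity

end Strips

/-! ### The duality -/

section Duality

variable {n m : ℕ} {Γ : Submodule ℤ (Euc n × Euc m)} {U : Set (Euc n)} {V : Set (Euc m)}

theorem expFun_neg_snd_eq {x y : Euc n × Euc m} (hx : x ∈ Γ) (hy : y ∈ dualLattice Γ) :
    expFun (-y.2) x.2 = expFun x.1 y.1 := by
  obtain ⟨k, hk⟩ := hy x hx
  have hsnd : inner ℝ (-y.2) x.2 = inner ℝ x.1 y.1 - k := by
    rw [inner_neg_left, real_inner_comm]
    linarith
  rw [expFun, expFun, hsnd, Complex.ofReal_sub, mul_sub, Complex.exp_sub, Complex.ofReal_intCast,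
    mul_comm _ (k : ℂ), Complex.exp_int_mul_two_pi_mul_I, div_one]

theorem fourier_bump_snd (φ : 𝓢(Euc m, ℂ)) {ε : ℝ} (hε : 0 < ε) {x y : Euc n × Euc m}
    (hx : x ∈ Γ) (hy : y ∈ dualLattice Γ) :
    𝓕 (bump φ ε x.2) y.2 = √(ε ^ m) • (expFun x.1 y.1 * 𝓕 (φ : Euc m → ℂ) (ε • y.2)) := by
  rw [fourier_bump φ hε, expFun_neg_snd_eq hx hy]

/-- The coefficient family on the dual lattice attached to a function `f` on `ℝⁿ` and a bump
profile `φ` of size `ε`: it is the family of inner products of a sum of bumps with the exponentials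
when `f` is a trigonometric polynomial, and the family of test coefficients in the Riesz
inequalities when `f` is a Schwartz function. -/
noncomputable def dualCoeff (f : Euc n → ℂ) (φ : 𝓢(Euc m, ℂ)) (ε : ℝ) (y : Euc n × Euc m) : ℂ :=
  √(ε ^ m) • (f y.1 * 𝓕 (φ : Euc m → ℂ) (ε • y.2))

theorem norm_sq_dualCoeff (f : Euc n → ℂ) (φ : 𝓢(Euc m, ℂ)) {ε : ℝ} (hε : 0 < ε)
    (y : Euc n × Euc m) :
    ‖dualCoeff f φ ε y‖ ^ 2 = ε ^ m * (‖f y.1‖ ^ 2 * ‖𝓕 (φ : Euc m → ℂ) (ε • y.2)‖ ^ 2) := by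
  rw [dualCoeff, norm_smul, norm_mul, mul_pow, mul_pow, Real.norm_of_nonneg (Real.sqrt_nonneg _),
    Real.sq_sqrt (by positivity)]

theorem contDiff_sum_mul_expFun {ι : Type*} (s : Finset ι) (c : ι → ℂ) (lam : ι → Euc n) :
    ContDiff ℝ ∞ fun x => ∑ i ∈ s, c i * expFun (lam i) x := by
  refine ContDiff.sum fun i _ => contDiff_const.mul (ContDiff.cexp (contDiff_const.mul ?_))
  exact Complex.ofRealCLM.contDiff.comp (contDiff_const.inner ℝ contDiff_id)

theorem norm_sq_sum_smul_restrictLp_expMap (hU : Bornology.IsBounded U) {ι : Type*} (s : Finset ι)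
    (c : ι → ℂ) (lam : ι → Euc n) :
    ‖∑ i ∈ s, c i • restrictLp hU (expMap (lam i))‖ ^ 2 =
      ∫ x in U, ‖∑ i ∈ s, c i * expFun (lam i) x‖ ^ 2 := by
  simp only [← map_smul, ← map_sum]
  rw [norm_sq_restrictLp]
  simp [expMap]

variable {u : Euc m} {φ : 𝓢(Euc m, ℂ)}

theorem IsUnitBump.eventually_inner_expMap_sum_smul_bumpLp (hφ : IsUnitBump φ u)
    (hV : Bornology.IsBounded V) (hu : ∀ x ∈ Γ, IsApproachDirection V u x.2)
    (s : Finset (sndStrip Γ V)) (c : sndStrip Γ V → ℂ) :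
    ∀ᶠ ε in 𝓝[>] 0, ∀ y ∈ dualLattice Γ,
      (inner ℂ (restrictLp hV (expMap y.2)) (∑ x ∈ s, c x • bumpLp hV φ ε x.1.1.2) : ℂ) =
        dualCoeff (fun z => ∑ x ∈ s, c x * expFun x.1.1.1 z) φ ε y := by
  have hzero : ∀ᶠ ε in 𝓝[>] 0, ∀ x ∈ s, ∀ z ∉ V, bump φ ε x.1.1.2 z = 0 := by
    refine (Filter.eventually_all_finset s).2 fun x _ => ?_
    filter_upwards [hφ.eventually_bump_eq_zero (hu _ x.1.2)] with ε hε z hz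
    exact hε z fun h => hz (h.2 x.2)
  filter_upwards [hzero, self_mem_nhdsWithin] with ε hzero hε y hy
  rw [dualCoeff, inner_sum, Finset.sum_mul, Finset.smul_sum]
  refine Finset.sum_congr rfl fun x hx => ?_
  rw [inner_smul_right, bumpLp, inner_restrictLp_expMap hV _ (hzero x hx), ContinuousMap.coe_mk,
    fourier_bump_snd φ hε x.1.2 hy, mul_smul_comm, mul_assoc]

theorem IsUnitBump.tendsto_norm_sq_sum_smul_bumpLp (hφ : IsUnitBump φ u)
    (hΓ : Set.InjOn Prod.snd (Γ : Set (Euc n × Euc m))) (hV : Bornology.IsBounded V)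
    (hu : ∀ x ∈ Γ, IsApproachDirection V u x.2) (s : Finset (sndStrip Γ V))
    (c : sndStrip Γ V → ℂ) :
    Tendsto (fun ε => ‖∑ x ∈ s, c x • bumpLp hV φ ε x.1.1.2‖ ^ 2) (𝓝[>] 0)
      (𝓝 (∑ x ∈ s, ‖c x‖ ^ 2)) := by
  have hinj : Function.Injective fun x : s => x.1.1.1.2 := fun x y h =>
    Subtype.ext (Subtype.ext (Subtype.ext (hΓ x.1.1.2 y.1.1.2 h)))
  have hlim := hφ.tendsto_norm_sq_tsum_smul_bumpLp hV hinj (fun x => hu _ x.1.1.2)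
    (a := fun x => c x) (r := 0) (Summable.of_finite)
  have hmem : {x : s | x.1.1.1.2 ∈ V} = Set.univ := Set.eq_univ_of_forall fun x => x.1.2
  simpa only [hmem, Set.indicator_univ, tsum_fintype,
    Finset.sum_coe_sort s fun x => ‖c x‖ ^ 2,
    fun ε => Finset.sum_coe_sort s fun x => c x • bumpLp hV φ ε x.1.1.2] using hlim

variable (Γ) [DiscreteTopology Γ] [IsZLattice ℝ Γ]

theorem IsUnitBump.tendsto_tsum_norm_sq_dualCoeff (hφ : IsUnitBump φ u)
    (hΓ : Set.InjOn Prod.snd (Γ : Set (Euc n × Euc m))) (hU : RiemannMeasurable U)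
    {f : Euc n → ℂ} (hf : ContDiff ℝ ∞ f) :
    Tendsto (fun ε => ∑' y : fstStrip (dualLattice Γ) U, ‖dualCoeff f φ ε y.1‖ ^ 2) (𝓝[>] 0)
      (𝓝 (dualDensity Γ * ∫ x in U, ‖f x‖ ^ 2)) := by
  have hlim := tendsto_pow_mul_tsum_norm_sq_fstStrip Γ hΓ hU hf (𝓕 φ)
  rw [SchwartzMap.integral_norm_sq_fourier, hφ.integral_norm_sq, mul_one, SchwartzMap.fourier_coe]
    at hlim
  refine hlim.congr' ?_
  filter_upwards [self_mem_nhdsWithin] with ε hε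
  simp only [norm_sq_dualCoeff _ _ hε, tsum_mul_left]

theorem rieszBounds_of_frameBounds (hΓ : Set.InjOn Prod.snd (Γ : Set (Euc n × Euc m)))
    (hU : RiemannMeasurable U) (hV : Bornology.IsBounded V)
    (hu : ∀ x ∈ Γ, IsApproachDirection V u x.2) {A B : ℝ}
    (h : FrameBounds A B fun y : fstStrip (dualLattice Γ) U => restrictLp hV (expMap y.1.1.2)) :
    RieszBounds (A / dualDensity Γ) (B / dualDensity Γ)
      fun x : sndStrip Γ V => restrictLp hU.bounded (expMap x.1.1.1) := by
  intro s c
  obtain ⟨φ, hφ⟩ := exists_isUnitBump u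
  have hnorm := hφ.tendsto_norm_sq_sum_smul_bumpLp hΓ hV hu s c
  have henergy := hφ.tendsto_tsum_norm_sq_dualCoeff Γ hΓ hU
    (contDiff_sum_mul_expFun s c fun x => x.1.1.1)
  rw [← norm_sq_sum_smul_restrictLp_expMap hU.bounded] at henergy
  have hframe : ∀ᶠ ε in 𝓝[>] 0, ∑' y : fstStrip (dualLattice Γ) U,
      ‖(inner ℂ (restrictLp hV (expMap y.1.1.2))
        (∑ x ∈ s, c x • bumpLp hV φ ε x.1.1.2) : ℂ)‖ ^ 2 =
      ∑' y : fstStrip (dualLattice Γ) U,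
        ‖dualCoeff (fun z => ∑ x ∈ s, c x * expFun x.1.1.1 z) φ ε y.1‖ ^ 2 := by
    filter_upwards [hφ.eventually_inner_expMap_sum_smul_bumpLp hV hu s c] with ε hinner
    exact tsum_congr fun y => by rw [hinner _ y.1.2]
  have hlower := le_of_tendsto_of_tendsto (hnorm.const_mul A) henergy
    (hframe.mono fun ε hε => (h _).2.1.trans_eq hε)
  have hupper := le_of_tendsto_of_tendsto henergy (hnorm.const_mul B)
    (hframe.mono fun ε hε => hε.symm.trans_le (h _).2.2)
  rw [div_mul_eq_mul_div, div_mul_eq_mul_div, div_le_iff₀' (dualDensity_pos Γ),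
    le_div_iff₀' (dualDensity_pos Γ)]
  exact ⟨hlower, hupper⟩

theorem exists_norm_bump_le (hV : Bornology.IsBounded V) (φ : 𝓢(Euc m, ℂ)) {ε : ℝ} (hε : ε ≠ 0)
    (r : ℕ) : ∃ C, ∀ v, ∀ z ∈ V, ‖bump φ ε v z‖ ≤ C * decayWeight r v := by
  obtain ⟨ψ, hψ⟩ := exists_schwartz_eq_bump φ hε 0
  obtain ⟨R, hR0, hR⟩ := hV.exists_pos_norm_le
  obtain ⟨C, -, hC⟩ := (decays_schwartz r ψ).exists_norm_add_le hR0.le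
  refine ⟨C, fun v z hz => ?_⟩
  have htranslate : bump φ ε v z = ψ (z + -v) := by
    rw [← hψ, bump, bump, sub_zero, sub_eq_add_neg]
  rw [htranslate]
  exact (hC z (-v) (hR z hz)).trans_eq (by rw [decayWeight, decayWeight, norm_neg])

theorem summable_norm_mul_decayWeight (K : 𝓢(Euc n, ℂ)) :
    Summable fun x : Γ => ‖K x.1.1‖ * decayWeight (n + m + 1) x.1.2 := by
  obtain ⟨C, -, hC⟩ := (decays_schwartz (n + m + 1) K).exists_norm_le
  refine ((summable_decayWeight_mul Γ (Nat.lt_succ_self _)).mul_left C).of_nonneg_of_le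
    (fun x => mul_nonneg (norm_nonneg _) (decayWeight_nonneg _ _)) fun x => ?_
  rw [← mul_assoc]
  exact mul_le_mul_of_nonneg_right (hC _) (decayWeight_nonneg _ _)

theorem summable_norm_sq_sndStrip (hV : Bornology.IsBounded V) (K : 𝓢(Euc n, ℂ)) :
    Summable fun x : sndStrip Γ V => ‖K x.1.1.1‖ ^ 2 := by
  obtain ⟨K', hK'⟩ := exists_schwartz_eq_norm_sq K
  obtain ⟨R, -, hR⟩ := hV.exists_pos_norm_le
  refine (((summable_norm_mul_decayWeight Γ K').subtype _).mul_left
    ((1 + R) ^ (n + m + 1))).of_nonneg_of_le (fun x => by positivity) fun x => ?_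
  rw [Function.comp_apply, hK', Complex.norm_of_nonneg (by positivity), mul_left_comm]
  exact le_mul_of_one_le_right (by positivity) (one_le_mul_decayWeight (hR _ x.2))

theorem summable_dualCoeff (f : 𝓢(Euc n, ℂ)) (φ : 𝓢(Euc m, ℂ)) {ε : ℝ} (hε : 0 < ε) :
    Summable fun y : dualLattice Γ => dualCoeff f φ ε y := by
  refine ((summable_schwartz_mul_dilate Γ f (𝓕 φ) hε).const_smul (√(ε ^ m))).congr fun y => ?_
  rw [dualCoeff, SchwartzMap.fourier_coe]

theorem tsum_dualCoeff_mul_expFun (f : 𝓢(Euc n, ℂ)) (φ : 𝓢(Euc m, ℂ)) {ε : ℝ} (hε : 0 < ε)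
    (z : Euc m) :
    ∑' y : dualLattice Γ, dualCoeff f φ ε y * expFun y.1.2 z =
      dualDensity Γ * ∑' x : Γ, 𝓕 (f : Euc n → ℂ) x.1.1 * bump φ ε x.1.2 z := by
  obtain ⟨w, hw, hw'⟩ := exists_schwartz_fourier_eq_bump φ hε z
  simp only [← hw', ← tsum_dualLattice_schwartz Γ f w]
  refine tsum_congr fun y => ?_
  rw [dualCoeff, hw, expFun_comm, mul_smul_comm, smul_mul_assoc]
  ring_nf

theorem hasSum_dualCoeff_smul_expMap (hV : Bornology.IsBounded V) {f : 𝓢(Euc n, ℂ)}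
    (hf : ∀ x ∉ U, f x = 0) (φ : 𝓢(Euc m, ℂ)) {ε : ℝ} (hε : 0 < ε) :
    HasSum (fun y : fstStrip (dualLattice Γ) U =>
        dualCoeff f φ ε y.1 • restrictLp hV (expMap y.1.1.2))
      ((dualDensity Γ : ℂ) • ∑' x : Γ, 𝓕 (f : Euc n → ℂ) x.1.1 • bumpLp hV φ ε x.1.2) := by
  have hsum := (summable_dualCoeff Γ f φ hε).norm
  have hbound (y : dualLattice Γ) (z : Euc m) :
      ‖dualCoeff f φ ε y * expFun y.1.2 z‖ ≤ ‖dualCoeff f φ ε y‖ := by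
    rw [norm_mul, norm_expFun, mul_one]
  let F : C(Euc m, ℂ) := ⟨fun z => ∑' y : dualLattice Γ, dualCoeff f φ ε y * expFun y.1.2 z,
    continuous_tsum (fun y => continuous_const.mul (continuous_expFun _)) hsum hbound⟩
  have hexp : HasSum (fun y : dualLattice Γ => dualCoeff f φ ε y • restrictLp hV (expMap y.1.2))
      (restrictLp hV F) := by
    simp only [← map_smul]
    exact hasSum_restrictLp hV hsum (fun y z _ => hbound y z) fun z _ => rfl
  obtain ⟨C, hC⟩ := exists_norm_bump_le hV φ hε.ne' (n + m + 1)
  have hbump : HasSum (fun x : Γ => (dualDensity Γ : ℂ) •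
      𝓕 (f : Euc n → ℂ) x.1.1 • bumpLp hV φ ε x.1.2) (restrictLp hV F) := by
    simp only [bumpLp, ← map_smul]
    refine hasSum_restrictLp hV
      ((summable_norm_mul_decayWeight Γ (𝓕 f)).mul_left (dualDensity Γ * C)) (fun x z hz => ?_)
      fun z _ => ?_
    · change ‖(dualDensity Γ : ℂ) * (𝓕 (f : Euc n → ℂ) x.1.1 * bump φ ε x.1.2 z)‖ ≤ _
      rw [SchwartzMap.fourier_coe, norm_mul, norm_mul,
        Complex.norm_of_nonneg (dualDensity_pos Γ).le, mul_assoc, mul_left_comm C]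
      have hle := hC x.1.2 z hz
      have hD := (dualDensity_pos Γ).le
      gcongr
    · exact tsum_mul_left.trans (tsum_dualCoeff_mul_expFun Γ f φ hε z).symm
  rw [← tsum_const_smul'', hbump.tsum_eq]
  refine (hasSum_subtype_iff_of_support_subset fun y hy => ?_).2 hexp
  by_contra hyU
  exact hy (by simp [dualCoeff, hf y.1.1 hyU])

theorem RieszBounds.dualCoeff_bounds (hU : RiemannMeasurable U) (hV : Bornology.IsBounded V)
    {A B : ℝ}
    (h : RieszBounds A B fun y : fstStrip (dualLattice Γ) U => restrictLp hV (expMap y.1.1.2))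
    {f : 𝓢(Euc n, ℂ)} (hf : ∀ x ∉ U, f x = 0) (φ : 𝓢(Euc m, ℂ)) {ε : ℝ} (hε : 0 < ε) :
    A * ∑' y : fstStrip (dualLattice Γ) U, ‖dualCoeff f φ ε y.1‖ ^ 2 ≤
        dualDensity Γ ^ 2 * ‖∑' x : Γ, 𝓕 f x.1.1 • bumpLp hV φ ε x.1.2‖ ^ 2 ∧
      dualDensity Γ ^ 2 * ‖∑' x : Γ, 𝓕 f x.1.1 • bumpLp hV φ ε x.1.2‖ ^ 2 ≤
        B * ∑' y : fstStrip (dualLattice Γ) U, ‖dualCoeff f φ ε y.1‖ ^ 2 := by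
  have hsummable : Summable fun y : fstStrip (dualLattice Γ) U => ‖dualCoeff f φ ε y.1‖ ^ 2 := by
    simpa only [norm_sq_dualCoeff _ _ hε, SchwartzMap.fourier_coe] using
      (summable_norm_sq_fstStrip Γ hU (f.smooth ⊤) (𝓕 φ) hε).mul_left (ε ^ m)
  simpa only [norm_smul, mul_pow, Complex.norm_of_nonneg (dualDensity_pos Γ).le,
    SchwartzMap.fourier_coe] using h.of_hasSum (hasSum_dualCoeff_smul_expMap Γ hV hf φ hε) hsummable

theorem frameBounds_of_rieszBounds (hΓ : Set.InjOn Prod.snd (Γ : Set (Euc n × Euc m)))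
    (hU : RiemannMeasurable U) (hV : Bornology.IsBounded V)
    (hu : ∀ x ∈ Γ, IsApproachDirection V u x.2) {A B : ℝ} (hB : 0 ≤ B)
    (h : RieszBounds A B fun y : fstStrip (dualLattice Γ) U => restrictLp hV (expMap y.1.1.2)) :
    FrameBounds (A / dualDensity Γ) (B / dualDensity Γ)
      fun x : sndStrip Γ V => restrictLp hU.bounded (expMap x.1.1.1) := by
  have hD := dualDensity_pos Γ
  refine FrameBounds.of_dense hU.dense_restrictLp_schwartz (by positivity) ?_
  rintro _ ⟨f, hf, rfl⟩
  obtain ⟨φ, hφ⟩ := exists_isUnitBump u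
  have hinj : Function.Injective fun x : Γ => x.1.2 := fun x y hxy =>
    Subtype.ext (hΓ x.2 y.2 hxy)
  have hnorm := hφ.tendsto_norm_sq_tsum_smul_bumpLp hV hinj (fun x => hu _ x.2)
    (summable_norm_mul_decayWeight Γ (𝓕 f))
  have henergy := hφ.tendsto_tsum_norm_sq_dualCoeff Γ hΓ hU (f.smooth ⊤)
  have hinner (x : sndStrip Γ V) : (inner ℂ (restrictLp hU.bounded (expMap x.1.1.1))
      (restrictLp hU.bounded ⟨f, f.continuous⟩) : ℂ) = 𝓕 f x.1.1.1 := by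
    rw [inner_restrictLp_expMap hU.bounded _ hf, ContinuousMap.coe_mk, SchwartzMap.fourier_coe]
  have hlower := le_of_tendsto_of_tendsto (henergy.const_mul A) (hnorm.const_mul _)
    (eventually_mem_nhdsWithin.mono fun ε hε => (h.dualCoeff_bounds Γ hU hV hf φ hε).1)
  have hupper := le_of_tendsto_of_tendsto (hnorm.const_mul _) (henergy.const_mul B)
    (eventually_mem_nhdsWithin.mono fun ε hε => (h.dualCoeff_bounds Γ hU hV hf φ hε).2)
  have hstrip : ∑' x : sndStrip Γ V, ‖𝓕 f x.1.1.1‖ ^ 2 =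
      ∑' x : Γ, {x : Γ | x.1.2 ∈ V}.indicator (fun x => ‖𝓕 f x.1.1‖ ^ 2) x :=
    tsum_subtype (sndStrip Γ V) fun x : Γ => ‖𝓕 f x.1.1‖ ^ 2
  simp only [hinner, hstrip, norm_sq_restrictLp, ContinuousMap.coe_mk]
  refine ⟨summable_norm_sq_sndStrip Γ hV (𝓕 f), ?_, ?_⟩
  · rw [div_mul_eq_mul_div, div_le_iff₀' hD]
    refine le_of_mul_le_mul_left ?_ hD
    linarith
  · rw [div_mul_eq_mul_div, le_div_iff₀' hD]
    refine le_of_mul_le_mul_left ?_ hD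
    linarith

end Duality

section Reindexing

variable {n m : ℕ} {Γ : Submodule ℤ (Euc n × Euc m)}

theorem eq_zero_of_forall_exists_inner_eq_int {E : Type*} [NormedAddCommGroup E]
    [InnerProductSpace ℝ E] {S : Set E} (hS : Dense S) {z : E}
    (h : ∀ x ∈ S, ∃ k : ℤ, inner ℝ x z = k) : z = 0 := by
  have hclosed : IsClosed {x : E | ∃ k : ℤ, inner ℝ x z = k} := by
    have hcont : Continuous fun x : E => inner ℝ x z := by fun_prop
    simpa only [Set.preimage, Set.mem_range, eq_comm] using
      Int.isClosedEmbedding_coe_real.isClosed_range.preimage hcont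
  by_contra hz
  obtain ⟨k, hk⟩ := hclosed.closure_subset_iff.2 h (hS ((1 / (2 * ‖z‖ ^ 2)) • z))
  rw [real_inner_smul_left, real_inner_self_eq_norm_sq] at hk
  field_simp at hk
  norm_cast at hk
  omega

theorem injOn_snd_dualLattice (h : Dense (Prod.fst '' (Γ : Set (Euc n × Euc m)))) :
    Set.InjOn Prod.snd (dualLattice Γ : Set (Euc n × Euc m)) := fun a ha b hb hab => by
  refine Prod.ext (sub_eq_zero.1 <| eq_zero_of_forall_exists_inner_eq_int h ?_) hab
  rintro _ ⟨x, hx, rfl⟩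
  simpa [hab] using sub_mem ha hb x hx

/-- The parametrisation of `Λ(Γ, V)` by the points of `Γ` whose second coordinate lies in `V`. -/
noncomputable def modelSetEquiv (h : Set.InjOn Prod.fst (Γ : Set (Euc n × Euc m)))
    (V : Set (Euc m)) : sndStrip Γ V ≃ modelSet Γ V :=
  .ofBijective (fun x => ⟨x.1.1.1, x.1, x.1.2, x.2, rfl⟩)
    ⟨fun x y hxy => Subtype.ext <| Subtype.ext <| h x.1.2 y.1.2 <| congrArg Subtype.val hxy,
      fun ⟨_, x, hx, hxV, hz⟩ => ⟨⟨⟨x, hx⟩, hxV⟩, Subtype.ext hz⟩⟩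

/-- The parametrisation of `Λ*(Γ, U)` by the points of `Γ*` whose first coordinate lies in `U`. -/
noncomputable def dualModelSetEquiv
    (h : Set.InjOn Prod.snd (dualLattice Γ : Set (Euc n × Euc m))) (U : Set (Euc n)) :
    fstStrip (dualLattice Γ) U ≃ dualModelSet Γ U :=
  .ofBijective (fun y => ⟨y.1.1.2, y.1, y.1.2, y.2, rfl⟩)
    ⟨fun x y hxy => Subtype.ext <| Subtype.ext <| h x.1.2 y.1.2 <| congrArg Subtype.val hxy,
      fun ⟨_, y, hy, hyU, hz⟩ => ⟨⟨⟨y, hy⟩, hyU⟩, Subtype.ext hz⟩⟩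

end Reindexing

theorem exists_isApproachDirection_of_frontier_inter_eq_empty_or {m : ℕ} {V P : Set (Euc m)}
    (h : frontier V ∩ P = ∅ ∨ IsSemiClosedInterval V) :
    ∃ u, ∀ v ∈ P, IsApproachDirection V u v := by
  rcases h with h | h
  · exact ⟨0, fun v hv => isApproachDirection_zero_of_notMem_frontier fun hvV =>
      Set.eq_empty_iff_forall_notMem.1 h v ⟨hvV, hv⟩⟩
  · exact h.exists_isApproachDirection.imp fun u hu v _ => hu v

end ModelSetDuality

open ModelSetDuality in
theorem mainTheorem4_general {n m : ℕ} (Γ : Submodule ℤ (Euc n × Euc m))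
    [DiscreteTopology Γ] [IsZLattice ℝ Γ]
    (hfst : Set.InjOn Prod.fst (Γ : Set (Euc n × Euc m)))
    (hsnd : Set.InjOn Prod.snd (Γ : Set (Euc n × Euc m)))
    (hdense : Dense (Prod.fst '' (Γ : Set (Euc n × Euc m))))
    {U : Set (Euc n)} (hU : RiemannMeasurable U) {V : Set (Euc m)} (hV : Bornology.IsBounded V)
    {u : Euc m} (hu : ∀ x ∈ Γ, IsApproachDirection V u x.2) :
    (IsFrame (expSystem (dualModelSet Γ U) hV) →
      IsRieszSequence (expSystem (modelSet Γ V) hU.bounded)) ∧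
    (IsRieszSequence (expSystem (dualModelSet Γ U) hV) →
      IsFrame (expSystem (modelSet Γ V) hU.bounded)) ∧
    (IsRieszBasis (expSystem (dualModelSet Γ U) hV) →
      IsRieszBasis (expSystem (modelSet Γ V) hU.bounded)) := by
  let e := modelSetEquiv hfst V
  let e' := dualModelSetEquiv (injOn_snd_dualLattice hdense) U
  have hD := dualDensity_pos Γ
  have hFrame : IsFrame (expSystem (dualModelSet Γ U) hV) →
      IsRieszSequence (expSystem (modelSet Γ V) hU.bounded) := by
    rintro ⟨A, B, hA, hB, h⟩
    have h' : FrameBounds A B (expSystem (dualModelSet Γ U) hV ∘ e') :=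
      (frameBounds_comp_equiv e').2 h
    exact ⟨A / dualDensity Γ, B / dualDensity Γ, div_pos hA hD, div_pos hB hD,
      (rieszBounds_comp_equiv e).1 (rieszBounds_of_frameBounds Γ hsnd hU hV hu h')⟩
  have hRiesz : IsRieszSequence (expSystem (dualModelSet Γ U) hV) →
      IsFrame (expSystem (modelSet Γ V) hU.bounded) := by
    rintro ⟨A, B, hA, hB, h⟩
    have h' : RieszBounds A B (expSystem (dualModelSet Γ U) hV ∘ e') :=
      (rieszBounds_comp_equiv e').2 h
    exact ⟨A / dualDensity Γ, B / dualDensity Γ, div_pos hA hD, div_pos hB hD,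
      (frameBounds_comp_equiv e).1 (frameBounds_of_rieszBounds Γ hsnd hU hV hu hB.le h')⟩
  exact ⟨hFrame, hRiesz, fun h => (hFrame h.isFrame).isRieszBasis (hRiesz h.isRieszSequence)⟩

theorem mainTheorem4 {n m : ℕ}
    (Γ : Submodule ℤ (ModelSetDuality.Euc n × ModelSetDuality.Euc m))
    [DiscreteTopology Γ] [IsZLattice ℝ Γ]
    (hΓ : ModelSetDuality.GeneralPosition Γ)
    (U : Set (ModelSetDuality.Euc n)) (hU : ModelSetDuality.RiemannMeasurable U)
    (V : Set (ModelSetDuality.Euc m)) (hV : ModelSetDuality.RiemannMeasurable V)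
    (hVΓ : frontier V ∩ Prod.snd '' (Γ : Set (ModelSetDuality.Euc n × ModelSetDuality.Euc m)) = ∅ ∨
      ModelSetDuality.IsSemiClosedInterval V) :
    (ModelSetDuality.IsFrame
        (ModelSetDuality.expSystem (ModelSetDuality.dualModelSet Γ U) hV.bounded) →
      ModelSetDuality.IsRieszSequence
        (ModelSetDuality.expSystem (ModelSetDuality.modelSet Γ V) hU.bounded)) ∧
    (ModelSetDuality.IsRieszSequence
        (ModelSetDuality.expSystem (ModelSetDuality.dualModelSet Γ U) hV.bounded) →
      ModelSetDuality.IsFrame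
        (ModelSetDuality.expSystem (ModelSetDuality.modelSet Γ V) hU.bounded)) ∧
    (ModelSetDuality.IsRieszBasis
        (ModelSetDuality.expSystem (ModelSetDuality.dualModelSet Γ U) hV.bounded) →
      ModelSetDuality.IsRieszBasis
        (ModelSetDuality.expSystem (ModelSetDuality.modelSet Γ V) hU.bounded)) := by
  obtain ⟨u, hu⟩ :=
    ModelSetDuality.exists_isApproachDirection_of_frontier_inter_eq_empty_or hVΓ
  exact mainTheorem4_general Γ hΓ.injOn_fst hΓ.injOn_snd hΓ.dense_fst hU hV.bounded
    fun x hx => hu _ ⟨x, hx, rfl⟩
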